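/- A partition is a finitely supported sequence $p=(p_k)_{k\ge1}$ of non-negative integers ($p_k$ is the number of summands equal to $k$); let $M(p)=\sum_k k\,p_k$. Let $u:[0,\infty)\to(0,\infty)$ be differentiable and such that $\lim_{x\to\infty}u'(x)$ exists and is finite, and put $E_k=u(\ln k)$, $k\ge1$. Assume that the ground state is unattainable, i.e. $\inf_k E_k/k$ is finite and is not attained at any $k$. Let $\beta\ge0$. For $\mu>0$ consider the grand canonical measure $$\mathbb P_\mu\{p\}=\frac1{Z_\mu}\exp\Big(-\beta\sum_kE_kp_k-\mu M(p)\Big)$$ on the set of all partitions, with $Z_\mu$ the normalising sum, and the scaled size distribution function $$F_\mu(x;p)=\frac1{\mu\,\mathbb E M}\sum_{k\ge x/\mu}p_k .$$ (For every $\mu>0$ the sum $Z_\mu$ is finite, $0<\mathbb E M<\infty$, and $F_\mu(x;\cdot)$ is integrable for every $x$.) We say that $F$ is the limit shape if $F(x)=\lim_{\mu\downarrow0}\mathbb E F_\mu(x;p)$ for all $x>0$ and, for every $y>0$ and $\varepsilon>0$, $$\lim_{\mu\downarrow0}\mathbb P_\mu\Big\{\sup_{x\ge y}|F_\mu(x;p)-F(x)|\ge\varepsilon\Big\}=0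 .$$ **Theorem.** The limit shape exists in each of the following cases: * $E_k=o(\ln k)$, any $\beta\ge0$, where for $\beta>0$ it is assumed that $\lim_{k\to\infty}E_k$ exists in $[0,\infty]$; * $E_k\sim\ln k$ and $\beta\in[0,1)$. The limit shapes, and the heights $h_\mu=1/(\mu\,\mathbb E M)$ given to the cells of the Young diagram (their widths being $\mu$), are as follows, as $\mu\downarrow0$, with $\mathrm{Li}_2(z)=\sum_{n\ge1}z^n/n^2$: * if $\beta=0$ and either $E_k=o(\ln k)$ or $E_k\sim\ln k$, or if $E_k\to0$: $F(x)=-\frac6{\pi^2}\ln(1-e^{-x})$ and $h_\mu\sim\frac6{\pi^2}\mu$; * if $E_k\to c\in(0,\infty)$: $F(x)=-\ln(1-e^{-\beta c-x})/\mathrm{Li}_2(e^{-\beta c})$ and $h_\mu\sim\mu/\mathrm{Li}_2(e^{-\beta c})$; * if $\beta>0$, $E_k\to\infty$ and $E_k=o(\ln k)$: $F(x)=e^{-x}$ and $h_\mu\sim\mu\,e^{\beta u(\ln(1/\mu))}$; * if $0<\beta<1$ and $E_k\sim\ln k$: $F(x)=\frac1{\Gamma(2-\beta)}\int_x^\infty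 y^{-\beta}e^{-y}\,dy$ and $h_\mu\sim\mu\,e^{\beta u(\ln(1/\mu))}/\Gamma(2-\beta)$; if moreover $E_k-\ln k\to0$, then $h_\mu\sim\mu^{1-\beta}/\Gamma(2-\beta)$. -/

import Mathlib

open Filter Topology MeasureTheory Asymptotics
open scoped ENNReal

noncomputable section

namespace LimitShape

/-- Integer partitions, encoded by their multiplicities: `p k` is the number of summands equal
to `k ≥ 1`. A sequence of multiplicities has finite mass iff it is finitely supported. The zero
sequence is the unique partition of `0`. -/
abbrev Config : Type := ℕ+ →₀ ℕ

/-- Every set of partitions is an event (the space is countable). -/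
instance instMeasurableSpaceConfig : MeasurableSpace Config := ⊤

/-- The size `∑ k, k * p k` of a partition, i.e. the number of monomers. -/
def mass (p : Config) : ℝ := p.sum fun k n => (k : ℝ) * (n : ℝ)

/-- The size distribution function: the number of summands greater than or equal to `x`. -/
def sizeDist (x : ℝ) (p : Config) : ℝ :=
  p.sum fun k n => if x ≤ (k : ℝ) then (n : ℝ) else 0

/-- The Hamiltonian `∑ k, E k * p k`. -/
def hamiltonian (E : ℕ+ → ℝ) (p : Config) : ℝ := p.sum fun k n => E k * (n : ℝ)

/-- The Gibbs weight `exp (-β H(p) - μ M(p))`. -/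
def weight (β : ℝ) (E : ℕ+ → ℝ) (μ : ℝ) (p : Config) : ℝ :=
  Real.exp (-β * hamiltonian E p - μ * mass p)

/-- The grand canonical partition function, with values in `[0, ∞]`. -/
def partitionFunction (β : ℝ) (E : ℕ+ → ℝ) (μ : ℝ) : ℝ≥0∞ :=
  ∑' p : Config, ENNReal.ofReal (weight β E μ p)

/-- The grand canonical measure: a partition `p` has probability
`exp (-β H(p) - μ M(p)) / Z`. -/
def grandCanonical (β : ℝ) (E : ℕ+ → ℝ) (μ : ℝ) : Measure Config :=
  Measure.sum fun p : Config =>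
    (ENNReal.ofReal (weight β E μ p) / partitionFunction β E μ) • Measure.dirac p

/-- The expected number of monomers. -/
def meanMass (β : ℝ) (E : ℕ+ → ℝ) (μ : ℝ) : ℝ :=
  ∫ p, mass p ∂(grandCanonical β E μ)

/-- The height `1 / (μ 𝔼 M)` given to the cells of the Young diagram (their width is `μ`). -/
def cellHeight (β : ℝ) (E : ℕ+ → ℝ) (μ : ℝ) : ℝ := 1 / (μ * meanMass β E μ)

/-- The scaled size distribution function `F_μ(x; p) = f(x / μ; p) / (μ 𝔼 M)`. -/
def scaledDist (β : ℝ) (E : ℕ+ → ℝ) (μ x : ℝ) (p : Config) : ℝ :=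
  sizeDist (x / μ) p / (μ * meanMass β E μ)

/-- All the objects above make sense at the parameter `μ`: the partition function is finite, the
grand canonical measure is a probability measure, and the expectations are those of integrable
functions. -/
structure WellDefined (β : ℝ) (E : ℕ+ → ℝ) (μ : ℝ) : Prop where
  partitionFunction_ne_top : partitionFunction β E μ ≠ ∞
  isProbabilityMeasure : IsProbabilityMeasure (grandCanonical β E μ)
  integrable_mass : Integrable mass (grandCanonical β E μ)
  meanMass_pos : 0 < meanMass β E μ
  integrable_scaledDist : ∀ x, Integrable (scaledDist β E μ x) (grandCanonical β E μ)

/-- `F` is the pointwise limit on `(0, ∞)` of the expectations of the scaled size distribution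
functions as `μ ↓ 0`. -/
def IsMeanLimit (β : ℝ) (E : ℕ+ → ℝ) (F : ℝ → ℝ) : Prop :=
  ∀ x : ℝ, 0 < x →
    Tendsto (fun μ : ℝ => ∫ p, scaledDist β E μ x p ∂(grandCanonical β E μ)) (𝓝[>] 0) (𝓝 (F x))

/-- The scaled size distribution functions concentrate near `F`: for all `y, ε > 0`, the
probability that `sup_{x ≥ y} |F_μ(x; p) - F(x)| ≥ ε` tends to `0` as `μ ↓ 0`. The supremum is
taken in `[0, ∞]`. -/
def ConcentratesAt (β : ℝ) (E : ℕ+ → ℝ) (F : ℝ → ℝ) : Prop :=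
  ∀ y : ℝ, 0 < y → ∀ ε : ℝ, 0 < ε →
    Tendsto
      (fun μ : ℝ => grandCanonical β E μ
        {p : Config | ENNReal.ofReal ε ≤
          ⨆ x ∈ Set.Ici y, ENNReal.ofReal |scaledDist β E μ x p - F x|})
      (𝓝[>] 0) (𝓝 0)

/-- `F` is the limit shape: the limit of the means, with vanishing fluctuations around it. -/
def IsLimitShape (β : ℝ) (E : ℕ+ → ℝ) (F : ℝ → ℝ) : Prop :=
  IsMeanLimit β E F ∧ ConcentratesAt β E F

/-- The assumption on `u : [0, ∞) → (0, ∞)`: strictly positive, differentiable, and with `u'`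
having a finite limit at infinity. (Only the restriction of `u` to `[0, ∞)` matters.) -/
structure AdmissiblePotential (u : ℝ → ℝ) : Prop where
  pos : ∀ x : ℝ, 0 ≤ x → 0 < u x
  differentiableOn : DifferentiableOn ℝ u (Set.Ici 0)
  exists_deriv_lim : ∃ σ : ℝ, Tendsto (deriv u) atTop (𝓝 σ)

/-- The internal energies `E_k = u (ln k)`. -/
def energy (u : ℝ → ℝ) (k : ℕ+) : ℝ := u (Real.log (k : ℝ))

/-- The ground state energy `inf_k E_k / k` is finite and is not attained at any `k`. -/
def GroundStateUnattainable (E : ℕ+ → ℝ) : Prop :=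
  BddBelow (Set.range fun k : ℕ+ => E k / (k : ℝ)) ∧
    ∀ k : ℕ+, sInf (Set.range fun j : ℕ+ => E j / (j : ℝ)) < E k / (k : ℝ)

/-- Sub-logarithmic growth, `E_k ≪ ln k`. -/
def SubLogarithmic (E : ℕ+ → ℝ) : Prop :=
  E =o[atTop] fun k : ℕ+ => Real.log (k : ℝ)

/-- Logarithmic growth, `E_k ∼ ln k`. -/
def Logarithmic (E : ℕ+ → ℝ) : Prop :=
  E ~[atTop] fun k : ℕ+ => Real.log (k : ℝ)

/-- The (nonnegative) energies have a limit in `[0, ∞]`. -/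
def HasExtendedLimit (E : ℕ+ → ℝ) : Prop :=
  ∃ L : ℝ≥0∞, Tendsto (fun k : ℕ+ => ENNReal.ofReal (E k)) atTop (𝓝 L)

/-- The dilogarithm `∑_{n ≥ 1} z ^ n / n ^ 2`, for `|z| ≤ 1`. -/
def dilog (z : ℝ) : ℝ := ∑' n : ℕ, z ^ (n + 1) / ((n : ℝ) + 1) ^ 2

/-- The classical (Szalay–Turán, Vershik) shape, normalised to have unit integral. -/
def classicalShape (x : ℝ) : ℝ := -(6 / Real.pi ^ 2) * Real.log (1 - Real.exp (-x))

/-- The shifted classical shape `-ln (1 - e^{-b-x}) / Li₂(e^{-b})`. -/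
def shiftedShape (b x : ℝ) : ℝ := -Real.log (1 - Real.exp (-b - x)) / dilog (Real.exp (-b))

/-- The shape given by the incomplete Gamma function. -/
def gammaShape (β x : ℝ) : ℝ :=
  1 / Real.Gamma (2 - β) * ∫ y in Set.Ioi x, y ^ (-β) * Real.exp (-y)

end LimitShape

end

open LimitShape

/-! Write $q_k=e^{-\beta E_k-\mu k}$. Adding $j$ summands equal to $k$ multiplies the weight of a
partition by $q_k^j$. This removal identity alone (`lintegral_ite_le_apply`) gives the first two
moments of the multiplicities: mean $q_k/(1-q_k)$, variance $q_k/(1-q_k)^2$, zero covariances. They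
are those of independent geometric variables, but independence itself is never needed.

Means. A sum over $k$ is the integral of a step function with cells of length $\mu$. If the mean
multiplicity at $k\approx t/\mu$, divided by a scale $L(\mu)$, tends to $\varphi(t)$ under a
suitable domination, then $\mu^2\,\mathbb EM/L\to N=\int_0^\infty t\varphi$, and the rescaled mean
profile tends to $N^{-1}\int_x^\infty\varphi$. This is `isLimitShape_of_scaling`.

Fluctuations. Above level $x/\mu$ the variances are at most $(1-e^{-x})^{-1}$ times the means, so
Chebyshev bounds the deviation at one point by a multiple of $h_\mu\sim\mu/(LN)\to0$. Monotonicity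
of the profiles upgrades finitely many points to a half-line.

Scales. If $\beta E_k\to b$, take $L=1$; then $\varphi(t)=1/(e^{b+t}-1)$ is of Bose–Einstein type.
If $E_k\to\infty$ and $u'\to\sigma$, then $u(\ln k)-u(\ln(1/\mu))\to\sigma\ln t$; with $L=e^{-\beta
u(\ln(1/\mu))}$ this gives $\varphi(t)=t^{-\beta\sigma}e^{-t}$. Sublogarithmic growth forces
$\sigma=0$, logarithmic growth $\sigma=1$. The condition $\beta\sigma<1$ makes $\mu/L$ vanish. -/

noncomputable section

namespace LimitShape

/-! ### Single-size quantities and additive statistics -/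

/-- The Boltzmann factor of a single summand equal to `k`. -/
def boltzmann (β : ℝ) (E : ℕ+ → ℝ) (μ : ℝ) (k : ℕ+) : ℝ := Real.exp (-(β * E k) - μ * k)

/-- The mean number of summands equal to `k`. -/
def occupation (β : ℝ) (E : ℕ+ → ℝ) (μ : ℝ) (k : ℕ+) : ℝ :=
  boltzmann β E μ k / (1 - boltzmann β E μ k)

/-- The variance of the number of summands equal to `k`. -/
def occupationVar (β : ℝ) (E : ℕ+ → ℝ) (μ : ℝ) (k : ℕ+) : ℝ :=
  boltzmann β E μ k / (1 - boltzmann β E μ k) ^ 2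

/-- The additive statistic `∑ k, c k * p k`. -/
def linStat (c : ℕ+ → ℝ) (p : Config) : ℝ := p.sum fun k n => c k * (n : ℝ)

lemma mass_eq_linStat : mass = linStat fun k => (k : ℝ) := rfl

lemma hamiltonian_eq_linStat (E : ℕ+ → ℝ) : hamiltonian E = linStat E := rfl

lemma sizeDist_eq_linStat (x : ℝ) :
    sizeDist x = linStat fun k => if x ≤ (k : ℝ) then 1 else 0 := by
  funext p
  simp [sizeDist, linStat, ite_mul]

lemma linStat_add (c : ℕ+ → ℝ) (p q : Config) :
    linStat c (p + q) = linStat c p + linStat c q :=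
  Finsupp.sum_add_index' (by simp) (by intros; push_cast; ring)

lemma linStat_single (c : ℕ+ → ℝ) (k : ℕ+) (j : ℕ) :
    linStat c (Finsupp.single k j) = c k * j := by
  simp [linStat]

lemma linStat_nonneg {c : ℕ+ → ℝ} (hc : ∀ k, 0 ≤ c k) (p : Config) : 0 ≤ linStat c p :=
  Finset.sum_nonneg fun k _ => mul_nonneg (hc k) (Nat.cast_nonneg _)

lemma ofReal_linStat {c : ℕ+ → ℝ} (hc : ∀ k, 0 ≤ c k) (p : Config) :
    ENNReal.ofReal (linStat c p) = ∑' k, ENNReal.ofReal (c k) * (p k : ℝ≥0∞) := by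
  rw [tsum_eq_sum (s := p.support), linStat, Finsupp.sum, ENNReal.ofReal_sum_of_nonneg]
  · refine Finset.sum_congr rfl fun k _ => ?_
    rw [ENNReal.ofReal_mul (hc k), ENNReal.ofReal_natCast]
  · exact fun k _ => mul_nonneg (hc k) (Nat.cast_nonneg _)
  · intro k hk
    simp [Finsupp.notMem_support_iff.1 hk]

/-! ### The grand canonical measure and its first two moments -/

section Weights

variable {β : ℝ} {E : ℕ+ → ℝ} {μ : ℝ}

lemma weight_add_single (p : Config) (k : ℕ+) (j : ℕ) :
    weight β E μ (p + Finsupp.single k j) = boltzmann β E μ k ^ j * weight β E μ p := by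
  simp only [weight, boltzmann, mass_eq_linStat, hamiltonian_eq_linStat, linStat_add,
    linStat_single, ← Real.exp_nat_mul, ← Real.exp_add]
  congr 1
  ring

lemma boltzmann_pos (k : ℕ+) : 0 < boltzmann β E μ k := Real.exp_pos _

lemma boltzmann_le_exp (hβE : ∀ k, 0 ≤ β * E k) (k : ℕ+) :
    boltzmann β E μ k ≤ Real.exp (-(μ * k)) :=
  Real.exp_le_exp.2 (by linarith [hβE k])

lemma boltzmann_lt_one (hβE : ∀ k, 0 ≤ β * E k) (hμ : 0 < μ) (k : ℕ+) :
    boltzmann β E μ k < 1 := by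
  refine (boltzmann_le_exp hβE k).trans_lt (Real.exp_lt_one_iff.2 ?_)
  have : (0 : ℝ) < k := by exact_mod_cast k.pos
  nlinarith

lemma one_sub_boltzmann_pos (hβE : ∀ k, 0 ≤ β * E k) (hμ : 0 < μ) (k : ℕ+) :
    0 < 1 - boltzmann β E μ k := sub_pos.2 (boltzmann_lt_one hβE hμ k)

lemma occupation_pos (hβE : ∀ k, 0 ≤ β * E k) (hμ : 0 < μ) (k : ℕ+) :
    0 < occupation β E μ k := div_pos (boltzmann_pos k) (one_sub_boltzmann_pos hβE hμ k)

lemma occupationVar_nonneg (k : ℕ+) : 0 ≤ occupationVar β E μ k :=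
  div_nonneg (boltzmann_pos k).le (sq_nonneg _)

/-- The terms are the tail probabilities of `p k` being at least `j + 1`, so the sum computes its
mean. -/
lemma tsum_boltzmann_pow (hβE : ∀ k, 0 ≤ β * E k) (hμ : 0 < μ) (k : ℕ+) :
    ∑' j : ℕ, ENNReal.ofReal (boltzmann β E μ k) ^ (j + 1) =
      ENNReal.ofReal (occupation β E μ k) := by
  have h0 := (boltzmann_pos (β := β) (E := E) (μ := μ) k).le
  have h1 := boltzmann_lt_one hβE hμ k
  have hs := summable_geometric_of_lt_one h0 h1
  simp_rw [← ENNReal.ofReal_pow h0]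
  rw [← ENNReal.ofReal_tsum_of_nonneg (fun j => pow_nonneg h0 _)
    ((summable_nat_add_iff 1).2 hs)]
  simp_rw [pow_succ']
  rw [tsum_mul_left, tsum_geometric_of_lt_one h0 h1]
  rfl

/-- The diagonal correction in the second moment: adding `j + 1` summands equal to `k` raises `p k`
by `j + 1`. -/
lemma tsum_boltzmann_pow_mul (hβE : ∀ k, 0 ≤ β * E k) (hμ : 0 < μ) (k : ℕ+) :
    ∑' j : ℕ, ENNReal.ofReal (boltzmann β E μ k) ^ (j + 1) * ((j + 1 : ℕ) : ℝ≥0∞) =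
      ENNReal.ofReal (occupationVar β E μ k) := by
  have h0 := (boltzmann_pos (β := β) (E := E) (μ := μ) k).le
  have h1 := boltzmann_lt_one hβE hμ k
  have hn : ‖boltzmann β E μ k‖ < 1 := by rwa [Real.norm_of_nonneg h0]
  have hs := (hasSum_coe_mul_geometric_of_norm_lt_one hn).summable
  have ht := (hasSum_coe_mul_geometric_of_norm_lt_one hn).tsum_eq
  rw [hs.tsum_eq_zero_add] at ht
  rw [occupationVar, ← ht, Nat.cast_zero, zero_mul, zero_add,
    ENNReal.ofReal_tsum_of_nonneg (fun j => by positivity) ((summable_nat_add_iff 1).2 hs)]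
  refine tsum_congr fun j => ?_
  rw [ENNReal.ofReal_mul (Nat.cast_nonneg _), ENNReal.ofReal_pow h0, ENNReal.ofReal_natCast,
    mul_comm]

/-- A partition is determined by its multiplicity at `k` and its remaining part, and the weight
factorises accordingly. Injectivity of this splitting is enough for an upper bound, which is all
that finiteness of the partition function requires. -/
lemma tsum_indicator_weight_le (hβE : ∀ k, 0 ≤ β * E k) (hμ : 0 < μ) (S : Finset ℕ+) :
    ∑' p : Config, (if p.support ⊆ S then ENNReal.ofReal (weight β E μ p) else 0) ≤
      ENNReal.ofReal (∏ k ∈ S, (1 - boltzmann β E μ k)⁻¹) := by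
  induction S using Finset.induction_on with
  | empty =>
    rw [tsum_eq_single 0]
    · simp [weight, hamiltonian, mass]
    · intro p hp
      exact if_neg (by simpa [Finset.subset_empty] using hp)
  | insert k S hk ih =>
    have h0 := (boltzmann_pos (β := β) (E := E) (μ := μ) k).le
    have hinj : Function.Injective fun p : Config => (p k, p.erase k) := by
      intro p q h
      simp only [Prod.mk.injEq] at h
      rw [← Finsupp.erase_add_single k p, ← Finsupp.erase_add_single k q, h.1, h.2]
    calc ∑' p : Config, (if p.support ⊆ insert k S then ENNReal.ofReal (weight β E μ p) else 0)
        ≤ ∑' p : Config, ENNReal.ofReal (boltzmann β E μ k) ^ (p k) *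
            (if (p.erase k).support ⊆ S then ENNReal.ofReal (weight β E μ (p.erase k)) else 0) := by
          refine ENNReal.tsum_le_tsum fun p => ?_
          split_ifs with h1 h2 h2
          · rw [← ENNReal.ofReal_pow h0, ← ENNReal.ofReal_mul (pow_nonneg h0 _),
              ← weight_add_single, Finsupp.erase_add_single]
          · refine absurd ?_ h2
            rw [Finsupp.support_erase]
            exact Finset.subset_insert_iff.1 h1
          · exact zero_le
          · exact zero_le
      _ ≤ ∑' x : ℕ × Config, ENNReal.ofReal (boltzmann β E μ k) ^ x.1 *
            (if x.2.support ⊆ S then ENNReal.ofReal (weight β E μ x.2) else 0) :=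
          ENNReal.tsum_comp_le_tsum_of_injective hinj fun x : ℕ × Config =>
            ENNReal.ofReal (boltzmann β E μ k) ^ x.1 *
              (if x.2.support ⊆ S then ENNReal.ofReal (weight β E μ x.2) else 0)
      _ = (∑' j : ℕ, ENNReal.ofReal (boltzmann β E μ k) ^ j) *
            ∑' p : Config, (if p.support ⊆ S then ENNReal.ofReal (weight β E μ p) else 0) := by
          rw [ENNReal.tsum_prod (f := fun j (p : Config) =>
            ENNReal.ofReal (boltzmann β E μ k) ^ j *
              (if p.support ⊆ S then ENNReal.ofReal (weight β E μ p) else 0))]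
          simp_rw [ENNReal.tsum_mul_left, ENNReal.tsum_mul_right]
      _ ≤ ENNReal.ofReal (1 - boltzmann β E μ k)⁻¹ *
            ENNReal.ofReal (∏ k ∈ S, (1 - boltzmann β E μ k)⁻¹) := by
          refine mul_le_mul' (le_of_eq ?_) ih
          simp_rw [← ENNReal.ofReal_pow h0]
          rw [← ENNReal.ofReal_tsum_of_nonneg (fun j => pow_nonneg h0 _)
            (summable_geometric_of_lt_one h0 (boltzmann_lt_one hβE hμ k)),
            tsum_geometric_of_lt_one h0 (boltzmann_lt_one hβE hμ k)]
      _ = _ := by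
          rw [Finset.prod_insert hk,
            ENNReal.ofReal_mul (inv_nonneg.2 (one_sub_boltzmann_pos hβE hμ k).le)]

lemma occupation_le (hβE : ∀ k, 0 ≤ β * E k) (hμ : 0 < μ) (k : ℕ+) :
    occupation β E μ k ≤ Real.exp (-(μ * k)) / (1 - Real.exp (-μ)) := by
  have hk : (1 : ℝ) ≤ k := by exact_mod_cast (one_le : 1 ≤ k)
  have h1 : Real.exp (-(μ * k)) ≤ Real.exp (-μ) := Real.exp_le_exp.2 (by nlinarith)
  have h2 : Real.exp (-μ) < 1 := Real.exp_lt_one_iff.2 (by linarith)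
  have h3 := boltzmann_le_exp (μ := μ) hβE k
  exact div_le_div₀ (Real.exp_pos _).le h3 (by linarith) (by linarith)

lemma summable_mul_occupation (hβE : ∀ k, 0 ≤ β * E k) (hμ : 0 < μ) :
    Summable fun k : ℕ+ => (k : ℝ) * occupation β E μ k := by
  have h := Real.summable_pow_mul_exp_neg_nat_mul 1 hμ
  have h' := (h.comp_injective PNat.coe_injective).mul_right (1 - Real.exp (-μ))⁻¹
  refine Summable.of_nonneg_of_le (fun k => ?_) (fun k => ?_) h'
  · exact mul_nonneg (Nat.cast_nonneg _) (occupation_pos hβE hμ k).le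
  · have := mul_le_mul_of_nonneg_left (occupation_le hβE hμ k) (Nat.cast_nonneg (α := ℝ) k)
    refine this.trans (le_of_eq ?_)
    simp only [Function.comp, pow_one, neg_mul]
    ring

lemma summable_occupation (hβE : ∀ k, 0 ≤ β * E k) (hμ : 0 < μ) :
    Summable (occupation β E μ) := by
  refine Summable.of_nonneg_of_le (fun k => (occupation_pos hβE hμ k).le) (fun k => ?_)
    (summable_mul_occupation hβE hμ)
  have hk : (1 : ℝ) ≤ k := by exact_mod_cast (one_le : 1 ≤ k)
  exact le_mul_of_one_le_left (occupation_pos hβE hμ k).le hk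

/-- Finitely many partitions involve finitely many sizes, and $(1-q)^{-1}=1+q/(1-q)\le e^{q/(1-q)}$
bounds the resulting finite products uniformly. -/
lemma partitionFunction_ne_top (hβE : ∀ k, 0 ≤ β * E k) (hμ : 0 < μ) :
    partitionFunction β E μ ≠ ∞ := by
  suffices h : partitionFunction β E μ ≤ ENNReal.ofReal (Real.exp (∑' k, occupation β E μ k)) from
    ne_top_of_le_ne_top ENNReal.ofReal_ne_top h
  rw [partitionFunction, ENNReal.tsum_eq_iSup_sum]
  refine iSup_le fun T => ?_
  calc ∑ p ∈ T, ENNReal.ofReal (weight β E μ p)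
      = ∑ p ∈ T, (if p.support ⊆ T.biUnion Finsupp.support
          then ENNReal.ofReal (weight β E μ p) else 0) :=
        Finset.sum_congr rfl fun p hp =>
          (if_pos (Finset.subset_biUnion_of_mem Finsupp.support hp)).symm
    _ ≤ _ := ENNReal.sum_le_tsum T
    _ ≤ _ := tsum_indicator_weight_le hβE hμ _
    _ ≤ _ := by
      refine ENNReal.ofReal_le_ofReal ?_
      calc ∏ k ∈ T.biUnion Finsupp.support, (1 - boltzmann β E μ k)⁻¹
          ≤ ∏ k ∈ T.biUnion Finsupp.support, Real.exp (occupation β E μ k) := by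
            refine Finset.prod_le_prod
              (fun k _ => inv_nonneg.2 (one_sub_boltzmann_pos hβE hμ k).le) fun k _ => ?_
            have h := one_sub_boltzmann_pos hβE hμ k
            have : (1 - boltzmann β E μ k)⁻¹ = occupation β E μ k + 1 := by
              rw [occupation]
              field_simp
              ring
            rw [this]
            exact Real.add_one_le_exp _
        _ = Real.exp (∑ k ∈ T.biUnion Finsupp.support, occupation β E μ k) :=
            (Real.exp_sum _ _).symm
        _ ≤ _ := Real.exp_le_exp.2 ((summable_occupation hβE hμ).sum_le_tsum _
            fun k _ => (occupation_pos hβE hμ k).le)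

lemma partitionFunction_ne_zero : partitionFunction β E μ ≠ 0 := by
  intro h
  have := ENNReal.tsum_eq_zero.1 h 0
  simp only [ENNReal.ofReal_eq_zero, weight] at this
  exact absurd this (not_le.2 (Real.exp_pos _))

lemma lintegral_grandCanonical (f : Config → ℝ≥0∞) :
    ∫⁻ p, f p ∂(grandCanonical β E μ) =
      ∑' p, ENNReal.ofReal (weight β E μ p) / partitionFunction β E μ * f p := by
  rw [grandCanonical, lintegral_sum_measure]
  refine tsum_congr fun p => ?_
  rw [lintegral_smul_measure, lintegral_dirac, smul_eq_mul]

lemma isProbabilityMeasure_grandCanonical (hβE : ∀ k, 0 ≤ β * E k) (hμ : 0 < μ) :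
    IsProbabilityMeasure (grandCanonical β E μ) := by
  constructor
  rw [← lintegral_one, lintegral_grandCanonical]
  simp_rw [mul_one, div_eq_mul_inv]
  rw [ENNReal.tsum_mul_right]
  exact ENNReal.mul_inv_cancel partitionFunction_ne_zero (partitionFunction_ne_top hβE hμ)

/-- Removing `j` summands equal to `k` multiplies the weight by a constant. -/
lemma lintegral_ite_le_apply (k : ℕ+) (j : ℕ) (f : Config → ℝ≥0∞) :
    ∫⁻ p, (if j ≤ p k then f p else 0) ∂(grandCanonical β E μ) =
      ENNReal.ofReal (boltzmann β E μ k) ^ j *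
        ∫⁻ p, f (p + Finsupp.single k j) ∂(grandCanonical β E μ) := by
  have h0 := (boltzmann_pos (β := β) (E := E) (μ := μ) k).le
  have hinj : Function.Injective fun p : Config => p + Finsupp.single k j :=
    add_left_injective _
  rw [lintegral_grandCanonical, lintegral_grandCanonical, ← hinj.tsum_eq, ← ENNReal.tsum_mul_left]
  · refine tsum_congr fun p => ?_
    rw [if_pos (by simp), weight_add_single, ENNReal.ofReal_mul (pow_nonneg h0 _),
      ENNReal.ofReal_pow h0, mul_div_assoc, mul_assoc]
  · intro p hp
    have hj : j ≤ p k := by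
      by_contra h
      simp [h] at hp
    -- Truncated subtraction is undone by adding back, because `j ≤ p k`.
    refine ⟨p - Finsupp.single k j, ?_⟩
    exact tsub_add_cancel_of_le (Finsupp.single_le_iff.2 hj)

/-- Layer-cake form of a multiplicity: the removal identity applies to each layer. -/
lemma natCast_eq_tsum (n : ℕ) : (n : ℝ≥0∞) = ∑' j : ℕ, if j + 1 ≤ n then 1 else 0 := by
  rw [tsum_eq_sum (s := Finset.range n)]
  · exact ((Finset.sum_congr rfl fun j hj =>
      if_pos (Nat.succ_le_of_lt (Finset.mem_range.1 hj))).trans (by simp)).symm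
  · intro j hj
    exact if_neg (by simpa using hj)

/-- With `f = 1` this yields the means, with `f` another multiplicity the second moments. -/
lemma lintegral_apply_mul (k : ℕ+) (f : Config → ℝ≥0∞) :
    ∫⁻ p, (p k : ℝ≥0∞) * f p ∂(grandCanonical β E μ) =
      ∑' j : ℕ, ENNReal.ofReal (boltzmann β E μ k) ^ (j + 1) *
        ∫⁻ p, f (p + Finsupp.single k (j + 1)) ∂(grandCanonical β E μ) := by
  simp_rw [natCast_eq_tsum, ← ENNReal.tsum_mul_right, ite_mul, one_mul, zero_mul]
  rw [lintegral_tsum fun _ => measurable_from_top.aemeasurable]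
  exact tsum_congr fun j => lintegral_ite_le_apply k (j + 1) f

lemma lintegral_apply (hβE : ∀ k, 0 ≤ β * E k) (hμ : 0 < μ) (k : ℕ+) :
    ∫⁻ p, (p k : ℝ≥0∞) ∂(grandCanonical β E μ) = ENNReal.ofReal (occupation β E μ k) := by
  have := isProbabilityMeasure_grandCanonical hβE hμ
  have h := lintegral_apply_mul (β := β) (E := E) (μ := μ) k fun _ => 1
  simpa [tsum_boltzmann_pow hβE hμ] using h

lemma lintegral_apply_mul_apply (hβE : ∀ k, 0 ≤ β * E k) (hμ : 0 < μ) (k l : ℕ+) :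
    ∫⁻ p, (p k : ℝ≥0∞) * (p l : ℝ≥0∞) ∂(grandCanonical β E μ) =
      ENNReal.ofReal (occupation β E μ k) * ENNReal.ofReal (occupation β E μ l) +
        if l = k then ENNReal.ofReal (occupationVar β E μ k) else 0 := by
  have := isProbabilityMeasure_grandCanonical hβE hμ
  rw [lintegral_apply_mul]
  simp_rw [Finsupp.add_apply, Nat.cast_add]
  have h : ∀ j : ℕ, ∫⁻ p : Config, ((p l : ℝ≥0∞) + (Finsupp.single k (j + 1) l : ℕ))
      ∂(grandCanonical β E μ) =
      ENNReal.ofReal (occupation β E μ l) + (Finsupp.single k (j + 1) l : ℕ) := fun j => by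
    rw [lintegral_add_left measurable_from_top, lintegral_apply hβE hμ]
    simp
  simp_rw [h, mul_add]
  rw [ENNReal.tsum_add, ENNReal.tsum_mul_right, tsum_boltzmann_pow hβE hμ]
  congr 1
  split_ifs with hkl
  · subst hkl
    simp_rw [Finsupp.single_eq_same]
    exact tsum_boltzmann_pow_mul hβE hμ l
  · simp [Finsupp.single_eq_of_ne hkl]

variable {c : ℕ+ → ℝ}

lemma lintegral_linStat (hβE : ∀ k, 0 ≤ β * E k) (hμ : 0 < μ) (hc : ∀ k, 0 ≤ c k)
    (hs : Summable fun k => c k * occupation β E μ k) :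
    ∫⁻ p, ENNReal.ofReal (linStat c p) ∂(grandCanonical β E μ) =
      ENNReal.ofReal (∑' k, c k * occupation β E μ k) := by
  simp_rw [ofReal_linStat hc]
  rw [lintegral_tsum fun _ => measurable_from_top.aemeasurable, ENNReal.ofReal_tsum_of_nonneg
    (fun k => mul_nonneg (hc k) (occupation_pos hβE hμ k).le) hs]
  refine tsum_congr fun k => ?_
  rw [lintegral_const_mul _ measurable_from_top, lintegral_apply hβE hμ, ENNReal.ofReal_mul (hc k)]

lemma integrable_linStat (hβE : ∀ k, 0 ≤ β * E k) (hμ : 0 < μ) (hc : ∀ k, 0 ≤ c k)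
    (hs : Summable fun k => c k * occupation β E μ k) :
    Integrable (linStat c) (grandCanonical β E μ) := by
  refine ⟨measurable_from_top.aestronglyMeasurable,
    (hasFiniteIntegral_iff_ofReal (ae_of_all _ (linStat_nonneg hc))).2 ?_⟩
  rw [lintegral_linStat hβE hμ hc hs]
  exact ENNReal.ofReal_lt_top

lemma integral_linStat (hβE : ∀ k, 0 ≤ β * E k) (hμ : 0 < μ) (hc : ∀ k, 0 ≤ c k)
    (hs : Summable fun k => c k * occupation β E μ k) :
    ∫ p, linStat c p ∂(grandCanonical β E μ) = ∑' k, c k * occupation β E μ k := by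
  rw [integral_eq_lintegral_of_nonneg_ae (ae_of_all _ (linStat_nonneg hc))
    measurable_from_top.aestronglyMeasurable, lintegral_linStat hβE hμ hc hs,
    ENNReal.toReal_ofReal (tsum_nonneg fun k => mul_nonneg (hc k) (occupation_pos hβE hμ k).le)]

/-- Expand the square as a double series. In `ℝ≥0∞` Tonelli exchanges sum and integral freely, and
only diagonal terms add to the square of the mean. -/
lemma lintegral_linStat_sq (hβE : ∀ k, 0 ≤ β * E k) (hμ : 0 < μ) (hc : ∀ k, 0 ≤ c k)
    (hs : Summable fun k => c k * occupation β E μ k)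
    (hv : Summable fun k => c k ^ 2 * occupationVar β E μ k) :
    ∫⁻ p, ENNReal.ofReal (linStat c p ^ 2) ∂(grandCanonical β E μ) =
      ENNReal.ofReal ((∑' k, c k * occupation β E μ k) ^ 2 +
        ∑' k, c k ^ 2 * occupationVar β E μ k) := by
  have hm0 : ∀ k, 0 ≤ c k * occupation β E μ k := fun k =>
    mul_nonneg (hc k) (occupation_pos hβE hμ k).le
  have hv0 : ∀ k, 0 ≤ c k ^ 2 * occupationVar β E μ k := fun k =>
    mul_nonneg (sq_nonneg _) (occupationVar_nonneg k)
  have hsq : ∀ p : Config, ENNReal.ofReal (linStat c p ^ 2) =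
      ∑' k, ∑' l, ENNReal.ofReal (c k) * ENNReal.ofReal (c l) *
        ((p k : ℝ≥0∞) * (p l : ℝ≥0∞)) := fun p => by
    rw [ENNReal.ofReal_pow (linStat_nonneg hc p), ofReal_linStat hc, sq, ← ENNReal.tsum_mul_right]
    refine tsum_congr fun k => ?_
    rw [← ENNReal.tsum_mul_left]
    exact tsum_congr fun l => by ring
  simp_rw [hsq]
  rw [lintegral_tsum fun _ => measurable_from_top.aemeasurable]
  have hterm : ∀ k, ∫⁻ p : Config, ∑' l, ENNReal.ofReal (c k) * ENNReal.ofReal (c l) *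
        ((p k : ℝ≥0∞) * (p l : ℝ≥0∞)) ∂(grandCanonical β E μ) =
      ENNReal.ofReal (c k * occupation β E μ k) *
        ENNReal.ofReal (∑' l, c l * occupation β E μ l) +
        ENNReal.ofReal (c k ^ 2 * occupationVar β E μ k) := fun k => by
    rw [lintegral_tsum fun _ => measurable_from_top.aemeasurable]
    simp_rw [lintegral_const_mul _ measurable_from_top, lintegral_apply_mul_apply hβE hμ, mul_add]
    rw [ENNReal.tsum_add, ENNReal.ofReal_tsum_of_nonneg hm0 hs, ← ENNReal.tsum_mul_left]
    congr 1
    · refine tsum_congr fun l => ?_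
      rw [ENNReal.ofReal_mul (hc k), ENNReal.ofReal_mul (hc l)]
      ring
    · rw [tsum_eq_single k fun l hl => by simp [hl], if_pos rfl,
        ENNReal.ofReal_mul (sq_nonneg _), ENNReal.ofReal_pow (hc k), sq]
  simp_rw [hterm]
  rw [ENNReal.tsum_add, ENNReal.tsum_mul_right, ← ENNReal.ofReal_tsum_of_nonneg hm0 hs,
    ← ENNReal.ofReal_tsum_of_nonneg hv0 hv, ← ENNReal.ofReal_mul (tsum_nonneg hm0),
    ← ENNReal.ofReal_add (mul_nonneg (tsum_nonneg hm0) (tsum_nonneg hm0)) (tsum_nonneg hv0), sq]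

lemma memLp_two_linStat (hβE : ∀ k, 0 ≤ β * E k) (hμ : 0 < μ) (hc : ∀ k, 0 ≤ c k)
    (hs : Summable fun k => c k * occupation β E μ k)
    (hv : Summable fun k => c k ^ 2 * occupationVar β E μ k) :
    MemLp (linStat c) 2 (grandCanonical β E μ) := by
  refine (memLp_two_iff_integrable_sq measurable_from_top.aestronglyMeasurable).2
    ⟨measurable_from_top.aestronglyMeasurable,
      (hasFiniteIntegral_iff_ofReal (ae_of_all _ fun p => sq_nonneg _)).2 ?_⟩
  rw [lintegral_linStat_sq hβE hμ hc hs hv]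
  exact ENNReal.ofReal_lt_top

lemma variance_linStat (hβE : ∀ k, 0 ≤ β * E k) (hμ : 0 < μ) (hc : ∀ k, 0 ≤ c k)
    (hs : Summable fun k => c k * occupation β E μ k)
    (hv : Summable fun k => c k ^ 2 * occupationVar β E μ k) :
    ProbabilityTheory.variance (linStat c) (grandCanonical β E μ) =
      ∑' k, c k ^ 2 * occupationVar β E μ k := by
  have := isProbabilityMeasure_grandCanonical hβE hμ
  have hv0 : ∀ k, 0 ≤ c k ^ 2 * occupationVar β E μ k := fun k =>
    mul_nonneg (sq_nonneg _) (occupationVar_nonneg k)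
  rw [ProbabilityTheory.variance_eq_sub (memLp_two_linStat hβE hμ hc hs hv),
    integral_linStat hβE hμ hc hs]
  simp only [Pi.pow_apply]
  rw [integral_eq_lintegral_of_nonneg_ae (ae_of_all _ fun p => sq_nonneg _)
    measurable_from_top.aestronglyMeasurable, lintegral_linStat_sq hβE hμ hc hs hv,
    ENNReal.toReal_ofReal (add_nonneg (sq_nonneg _) (tsum_nonneg hv0))]
  ring

lemma summable_sizeDist (hβE : ∀ k, 0 ≤ β * E k) (hμ : 0 < μ) (x : ℝ) :
    Summable fun k : ℕ+ => (if x ≤ (k : ℝ) then 1 else 0 : ℝ) * occupation β E μ k := by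
  refine Summable.of_nonneg_of_le (fun k => ?_) (fun k => ?_) (summable_occupation hβE hμ)
  · exact mul_nonneg (by split_ifs <;> simp) (occupation_pos hβE hμ k).le
  · exact mul_le_of_le_one_left (occupation_pos hβE hμ k).le (by split_ifs <;> simp)

lemma meanMass_eq_tsum (hβE : ∀ k, 0 ≤ β * E k) (hμ : 0 < μ) :
    meanMass β E μ = ∑' k : ℕ+, (k : ℝ) * occupation β E μ k :=
  integral_linStat hβE hμ (fun _ => Nat.cast_nonneg _) (summable_mul_occupation hβE hμ)

lemma meanMass_pos (hβE : ∀ k, 0 ≤ β * E k) (hμ : 0 < μ) : 0 < meanMass β E μ := by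
  rw [meanMass_eq_tsum hβE hμ]
  refine (summable_mul_occupation hβE hμ).tsum_pos
    (fun k => mul_nonneg (Nat.cast_nonneg _) (occupation_pos hβE hμ k).le) 1 ?_
  exact mul_pos (by simp) (occupation_pos hβE hμ 1)

lemma integrable_sizeDist (hβE : ∀ k, 0 ≤ β * E k) (hμ : 0 < μ) (x : ℝ) :
    Integrable (sizeDist x) (grandCanonical β E μ) := by
  rw [sizeDist_eq_linStat]
  exact integrable_linStat hβE hμ (fun _ => by split_ifs <;> simp) (summable_sizeDist hβE hμ x)

lemma integral_sizeDist (hβE : ∀ k, 0 ≤ β * E k) (hμ : 0 < μ) (x : ℝ) :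
    ∫ p, sizeDist x p ∂(grandCanonical β E μ) =
      ∑' k : ℕ+, (if x ≤ (k : ℝ) then 1 else 0 : ℝ) * occupation β E μ k := by
  rw [sizeDist_eq_linStat]
  exact integral_linStat hβE hμ (fun _ => by split_ifs <;> simp) (summable_sizeDist hβE hμ x)

theorem wellDefined (hβE : ∀ k, 0 ≤ β * E k) (hμ : 0 < μ) : WellDefined β E μ where
  partitionFunction_ne_top := partitionFunction_ne_top hβE hμ
  isProbabilityMeasure := isProbabilityMeasure_grandCanonical hβE hμ
  integrable_mass := integrable_linStat hβE hμ (fun _ => Nat.cast_nonneg _)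
    (summable_mul_occupation hβE hμ)
  meanMass_pos := meanMass_pos hβE hμ
  integrable_scaledDist x := (integrable_sizeDist hβE hμ (x / μ)).div_const _

/-- Above the level `x / μ` the variances are comparable to the means. -/
lemma occupationVar_le (hβE : ∀ k, 0 ≤ β * E k) (hμ : 0 < μ) {x : ℝ} (hx : 0 < x) {k : ℕ+}
    (hk : x / μ ≤ k) :
    occupationVar β E μ k ≤ (1 - Real.exp (-x))⁻¹ * occupation β E μ k := by
  have h1 : boltzmann β E μ k ≤ Real.exp (-x) := by
    refine (boltzmann_le_exp hβE k).trans (Real.exp_le_exp.2 ?_)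
    rw [div_le_iff₀ hμ] at hk
    linarith
  have h2 : Real.exp (-x) < 1 := Real.exp_lt_one_iff.2 (by linarith)
  have h3 := one_sub_boltzmann_pos hβE hμ k
  have h4 : occupationVar β E μ k = (1 - boltzmann β E μ k)⁻¹ * occupation β E μ k := by
    rw [occupation, occupationVar]
    field_simp
  rw [h4]
  exact mul_le_mul_of_nonneg_right (inv_anti₀ (by linarith) (by linarith))
    (occupation_pos hβE hμ k).le

lemma sizeDist_variance_le (hβE : ∀ k, 0 ≤ β * E k) (hμ : 0 < μ) {x : ℝ} (hx : 0 < x) :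
    MemLp (sizeDist (x / μ)) 2 (grandCanonical β E μ) ∧
    ProbabilityTheory.variance (sizeDist (x / μ)) (grandCanonical β E μ) ≤
      (1 - Real.exp (-x))⁻¹ * ∫ p, sizeDist (x / μ) p ∂(grandCanonical β E μ) := by
  have hle : ∀ k : ℕ+, (if x / μ ≤ (k : ℝ) then 1 else 0 : ℝ) ^ 2 * occupationVar β E μ k ≤
      (1 - Real.exp (-x))⁻¹ * ((if x / μ ≤ (k : ℝ) then 1 else 0 : ℝ) * occupation β E μ k) := by
    intro k
    split_ifs with h
    · simpa using occupationVar_le hβE hμ hx h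
    · simp
  have hs := summable_sizeDist hβE hμ (x / μ)
  have hv : Summable fun k : ℕ+ =>
      (if x / μ ≤ (k : ℝ) then 1 else 0 : ℝ) ^ 2 * occupationVar β E μ k :=
    Summable.of_nonneg_of_le (fun k => mul_nonneg (sq_nonneg _) (occupationVar_nonneg k)) hle
      (hs.mul_left _)
  have hc : ∀ k : ℕ+, (0 : ℝ) ≤ if x / μ ≤ (k : ℝ) then 1 else 0 := fun _ => by
    split_ifs <;> simp
  rw [integral_sizeDist hβE hμ, sizeDist_eq_linStat, variance_linStat hβE hμ hc hs hv]
  refine ⟨memLp_two_linStat hβE hμ hc hs hv, ?_⟩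
  rw [← tsum_mul_left]
  exact hv.tsum_le_tsum hle (hs.mul_left _)

end Weights

/-! ### Concentration around the mean, uniformly on half-lines -/

/-- Closeness to a continuous function vanishing at infinity, on a half-line, can be tested at
finitely many points for nonnegative antitone functions. -/
lemma exists_finset_test {F : ℝ → ℝ} {y : ℝ} (hF : ContinuousOn F (Set.Ici y))
    (hF0 : Tendsto F atTop (𝓝 0)) {ε : ℝ} (hε : 0 < ε) :
    ∃ T : Finset ℝ, (∀ g ∈ T, y ≤ g) ∧ ∀ G : ℝ → ℝ, Antitone G → (∀ x, 0 ≤ G x) →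
      (∀ g ∈ T, |G g - F g| < ε) → ∀ x, y ≤ x → |G x - F x| ≤ 3 * ε := by
  -- Beyond `R`, `|F| < ε`, and `0 ≤ G x ≤ G R < 2ε` by monotonicity; this tail is what costs `3ε`.
  obtain ⟨R, hR⟩ := eventually_atTop.1 ((hF0.eventually (Metric.ball_mem_nhds 0 hε)).and
    (eventually_ge_atTop y))
  have hyR : y ≤ R := (hR R le_rfl).2
  have hR' : ∀ x, R ≤ x → |F x| < ε := fun x hx => by
    simpa [Real.dist_eq] using (hR x hx).1
  -- The grid point to the right of `x ≤ R` may overshoot `R`, by at most the mesh `d ≤ 1`.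
  have huc := isCompact_Icc.uniformContinuousOn_of_continuous
    (hF.mono (Set.Icc_subset_Ici_self : Set.Icc y (R + 1) ⊆ _))
  obtain ⟨δ, hδ, hδF⟩ := Metric.uniformContinuousOn_iff.1 huc ε hε
  set d := min (δ / 2) 1 with hd
  have hd0 : 0 < d := lt_min (by linarith) one_pos
  have hd1 : d ≤ 1 := min_le_right _ _
  have hdδ : d < δ := (min_le_left _ _).trans_lt (by linarith)
  -- The range ends with `+ 2` so that it contains the right endpoint of the cell of `R`.
  refine ⟨insert R ((Finset.range (⌊(R - y) / d⌋₊ + 2)).image fun i : ℕ => y + i * d), ?_, ?_⟩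
  · intro g hg
    rcases Finset.mem_insert.1 hg with rfl | hg
    · exact hyR
    · obtain ⟨i, -, rfl⟩ := Finset.mem_image.1 hg
      have : 0 ≤ (i : ℝ) * d := by positivity
      linarith
  intro G hG hG0 hT x hx
  rcases le_total R x with hRx | hxR
  · have h1 := abs_lt.1 (hT R (Finset.mem_insert_self _ _))
    have h2 := abs_lt.1 (hR' R le_rfl)
    have h3 := abs_lt.1 (hR' x hRx)
    have h4 := hG hRx
    have h5 := hG0 x
    rw [abs_le]
    constructor <;> linarith
  · set i := ⌊(x - y) / d⌋₊ with hi
    have hi0 : 0 ≤ (x - y) / d := div_nonneg (by linarith) hd0.le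
    have hi1 : (i : ℝ) * d ≤ x - y := (le_div_iff₀ hd0).1 (Nat.floor_le hi0)
    have hi2 : x - y < ((i : ℝ) + 1) * d := (div_lt_iff₀ hd0).1 (Nat.lt_floor_add_one _)
    have hid : 0 ≤ (i : ℝ) * d := by positivity
    have hle : i ≤ ⌊(R - y) / d⌋₊ := Nat.floor_mono (by gcongr)
    have hmem : ∀ j, j ≤ i + 1 → y + (j : ℝ) * d ∈
        insert R ((Finset.range (⌊(R - y) / d⌋₊ + 2)).image fun i : ℕ => y + i * d) :=
      fun j hj => Finset.mem_insert_of_mem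
        (Finset.mem_image_of_mem _ (Finset.mem_range.2 (by omega)))
    have h1 := abs_lt.1 (hT _ (hmem i (by omega)))
    have h2 := abs_lt.1 (hT _ (hmem (i + 1) le_rfl))
    push_cast at h2
    have h3 : G x ≤ G (y + i * d) := hG (by linarith)
    have h4 : G (y + (i + 1) * d) ≤ G x := hG (by linarith)
    have hxm : x ∈ Set.Icc y (R + 1) := ⟨hx, by linarith⟩
    have h5 := hδF x hxm (y + i * d) ⟨by linarith, by linarith⟩
      (by rw [Real.dist_eq, abs_lt]; constructor <;> linarith)
    have h6 := hδF x hxm (y + (i + 1) * d) ⟨by linarith, by linarith⟩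
      (by rw [Real.dist_eq, abs_lt]; constructor <;> linarith)
    rw [Real.dist_eq, abs_lt] at h5 h6
    rw [abs_le]
    constructor <;> linarith

lemma sizeDist_antitone (p : Config) : Antitone fun x => sizeDist x p := by
  intro x y hxy
  refine Finset.sum_le_sum fun k _ => ?_
  dsimp only
  split_ifs with h1 h2
  · exact le_rfl
  · exact absurd (hxy.trans h1) h2
  · exact Nat.cast_nonneg _
  · exact le_rfl

lemma sizeDist_nonneg (x : ℝ) (p : Config) : 0 ≤ sizeDist x p :=
  Finset.sum_nonneg fun k _ => by dsimp only; split_ifs <;> simp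

section Concentration

variable {β : ℝ} {E : ℕ+ → ℝ} {F : ℝ → ℝ}

lemma scaledDist_eq (μ x : ℝ) :
    scaledDist β E μ x = fun p => cellHeight β E μ * sizeDist (x / μ) p := by
  funext p
  rw [scaledDist, cellHeight]
  ring

/-- Chebyshev: scaling multiplies the variance by $h_\mu^2$, and the unscaled variance is at most a
constant times the unscaled mean, so one factor $h_\mu\to0$ is left over. Half of `η` is spent on
the distance of the mean from its limit. -/
lemma tendsto_measure_abs_scaledDist_sub (hβE : ∀ k, 0 ≤ β * E k)
    (hh : Tendsto (cellHeight β E) (𝓝[>] 0) (𝓝 0)) (hF : IsMeanLimit β E F)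
    {x : ℝ} (hx : 0 < x) {η : ℝ} (hη : 0 < η) :
    Tendsto (fun μ => grandCanonical β E μ {p | η ≤ |scaledDist β E μ x p - F x|})
      (𝓝[>] 0) (𝓝 0) := by
  have hmean := hF x hx
  have hbound : Tendsto (fun μ => ENNReal.ofReal ((cellHeight β E μ * (1 - Real.exp (-x))⁻¹ *
      ∫ p, scaledDist β E μ x p ∂(grandCanonical β E μ)) / (η / 2) ^ 2)) (𝓝[>] 0) (𝓝 0) := by
    have h := (((hh.mul_const (1 - Real.exp (-x))⁻¹).mul hmean).div_const ((η / 2) ^ 2))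
    simp only [zero_mul, zero_div] at h
    simpa using ENNReal.tendsto_ofReal h
  refine tendsto_of_tendsto_of_tendsto_of_le_of_le' tendsto_const_nhds hbound
    (Eventually.of_forall fun _ => zero_le) ?_
  filter_upwards [self_mem_nhdsWithin, hmean.eventually (Metric.ball_mem_nhds (F x) (half_pos hη))]
    with μ hμ hμF
  have hμ : 0 < μ := hμ
  have := isProbabilityMeasure_grandCanonical hβE hμ
  obtain ⟨hmem, hvar⟩ := sizeDist_variance_le hβE hμ hx
  have hmem' : MemLp (scaledDist β E μ x) 2 (grandCanonical β E μ) := by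
    rw [scaledDist_eq]
    exact hmem.const_mul _
  have hvar' : ProbabilityTheory.variance (scaledDist β E μ x) (grandCanonical β E μ) ≤
      cellHeight β E μ * (1 - Real.exp (-x))⁻¹ *
        ∫ p, scaledDist β E μ x p ∂(grandCanonical β E μ) := by
    rw [scaledDist_eq, ProbabilityTheory.variance_const_mul, integral_const_mul]
    calc _ ≤ cellHeight β E μ ^ 2 * _ := mul_le_mul_of_nonneg_left hvar (sq_nonneg _)
      _ = _ := by ring
  calc grandCanonical β E μ {p | η ≤ |scaledDist β E μ x p - F x|}
      ≤ grandCanonical β E μ {p | η / 2 ≤ |scaledDist β E μ x p -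
          ∫ p, scaledDist β E μ x p ∂(grandCanonical β E μ)|} := by
        refine measure_mono fun p (hp : η ≤ _) => ?_
        rw [Real.dist_eq] at hμF
        have := abs_sub_le (scaledDist β E μ x p)
          (∫ p, scaledDist β E μ x p ∂(grandCanonical β E μ)) (F x)
        show η / 2 ≤ _
        linarith
    _ ≤ _ := ProbabilityTheory.meas_ge_le_variance_div_sq hmem' (half_pos hη)
    _ ≤ _ := ENNReal.ofReal_le_ofReal (by gcongr)

/-- The limit of the means is the limit shape if the heights of the cells vanish. -/
theorem IsMeanLimit.isLimitShape (hβE : ∀ k, 0 ≤ β * E k)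
    (hh : Tendsto (cellHeight β E) (𝓝[>] 0) (𝓝 0)) (hF : IsMeanLimit β E F)
    (hFc : ContinuousOn F (Set.Ioi 0)) (hF0 : Tendsto F atTop (𝓝 0)) :
    IsLimitShape β E F := by
  refine ⟨hF, fun y hy ε hε => ?_⟩
  -- With `ε / 4` at the test points the supremum is at most `3 * (ε / 4) < ε`.
  obtain ⟨T, hTy, hT⟩ := exists_finset_test
    (hFc.mono fun x hx => hy.trans_le hx : ContinuousOn F (Set.Ici y)) hF0
    (by linarith : 0 < ε / 4)
  have hsum : Tendsto (fun μ => ∑ g ∈ T, grandCanonical β E μ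
      {p | ε / 4 ≤ |scaledDist β E μ g p - F g|}) (𝓝[>] 0) (𝓝 0) := by
    have := tendsto_finsetSum T fun g hg =>
      tendsto_measure_abs_scaledDist_sub hβE hh hF (hy.trans_le (hTy g hg))
        (by linarith : 0 < ε / 4)
    simpa using this
  refine tendsto_of_tendsto_of_tendsto_of_le_of_le' tendsto_const_nhds hsum
    (Eventually.of_forall fun _ => zero_le) ?_
  filter_upwards [self_mem_nhdsWithin] with μ hμ
  have hμ : 0 < μ := hμ
  refine (measure_mono fun p hp => ?_).trans (measure_biUnion_finset_le T _)
  by_contra hcon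
  simp only [Set.mem_iUnion, Set.mem_ofPred_eq, not_exists, not_le] at hcon
  have hc : 0 < μ * meanMass β E μ := mul_pos hμ (meanMass_pos hβE hμ)
  have hle := hT (fun x => scaledDist β E μ x p)
    (fun a b hab => div_le_div_of_nonneg_right
      (sizeDist_antitone p (div_le_div_of_nonneg_right hab hμ.le)) hc.le)
    (fun x => div_nonneg (sizeDist_nonneg _ p) hc.le) hcon
  have hsup : ⨆ x ∈ Set.Ici y, ENNReal.ofReal |scaledDist β E μ x p - F x| ≤
      ENNReal.ofReal (3 * (ε / 4)) :=
    iSup₂_le fun x hx => ENNReal.ofReal_le_ofReal (hle x hx)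
  have : ENNReal.ofReal ε ≤ ENNReal.ofReal (3 * (ε / 4)) := le_trans hp hsup
  rw [ENNReal.ofReal_le_ofReal_iff (by linarith)] at this
  linarith

end Concentration

/-! ### Series as integrals of step functions -/

instance instMeasurableSpacePNat : MeasurableSpace ℕ+ := ⊤

instance instDiscreteMeasurableSpacePNat : DiscreteMeasurableSpace ℕ+ := ⟨fun _ => trivial⟩

/-- The index `k` of the cell `[μ (k - 1), μ k)` containing `t`. -/
def cellIdx (μ t : ℝ) : ℕ+ := Nat.succPNat ⌊t / μ⌋₊

lemma cellIdx_coe (μ t : ℝ) : ((cellIdx μ t : ℕ) : ℝ) = ⌊t / μ⌋₊ + 1 := by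
  simp [cellIdx]

lemma lt_mul_cellIdx {μ : ℝ} (hμ : 0 < μ) (t : ℝ) : t < μ * (cellIdx μ t : ℕ) := by
  rw [cellIdx_coe, mul_comm, ← div_lt_iff₀ hμ]
  exact Nat.lt_floor_add_one _

lemma mul_cellIdx_le {μ t : ℝ} (hμ : 0 < μ) (ht : 0 ≤ t) : μ * (cellIdx μ t : ℕ) ≤ t + μ := by
  have h := (le_div_iff₀ hμ).1 (Nat.floor_le (div_nonneg ht hμ.le))
  rw [cellIdx_coe]
  linarith

lemma tendsto_mul_cellIdx {t : ℝ} (ht : 0 ≤ t) :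
    Tendsto (fun μ : ℝ => μ * (cellIdx μ t : ℕ)) (𝓝[>] 0) (𝓝 t) := by
  have h : Tendsto (fun μ : ℝ => t + μ) (𝓝[>] 0) (𝓝 t) := by
    have : Tendsto (fun μ : ℝ => t + μ) (𝓝 0) (𝓝 (t + 0)) := by
      apply Continuous.tendsto; fun_prop
    rw [add_zero] at this
    exact this.mono_left nhdsWithin_le_nhds
  refine tendsto_of_tendsto_of_tendsto_of_le_of_le' tendsto_const_nhds h ?_ ?_
  · filter_upwards [self_mem_nhdsWithin] with μ hμ using (lt_mul_cellIdx hμ t).le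
  · filter_upwards [self_mem_nhdsWithin] with μ hμ using mul_cellIdx_le hμ ht

lemma tendsto_cellIdx_coe {t : ℝ} (ht : 0 < t) :
    Tendsto (fun μ : ℝ => ((cellIdx μ t : ℕ) : ℝ)) (𝓝[>] 0) atTop := by
  refine tendsto_atTop_mono' _ ?_ (tendsto_inv_nhdsGT_zero.const_mul_atTop ht)
  filter_upwards [self_mem_nhdsWithin] with μ hμ
  have hμ : 0 < μ := hμ
  rw [← div_eq_mul_inv, div_le_iff₀' hμ]
  exact (lt_mul_cellIdx hμ t).le

lemma tendsto_cellIdx {t : ℝ} (ht : 0 < t) :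
    Tendsto (fun μ : ℝ => cellIdx μ t) (𝓝[>] 0) atTop := by
  refine tendsto_atTop.2 fun k => ?_
  filter_upwards [(tendsto_cellIdx_coe ht).eventually_ge_atTop (k : ℝ)] with μ hμ
  exact_mod_cast hμ

lemma measurable_cellIdx (μ : ℝ) : Measurable (cellIdx μ) := by
  have h : Measurable fun n : ℕ => Nat.succPNat n := measurable_from_top
  exact h.comp (Nat.measurable_floor.comp (measurable_id.div_const μ))

/-- Every index is the image of exactly one cell, and each cell has length `μ`. -/
lemma map_cellIdx {μ : ℝ} (hμ : 0 < μ) :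
    (volume.restrict (Set.Ioi (0 : ℝ))).map (cellIdx μ) = ENNReal.ofReal μ • Measure.count := by
  refine Measure.ext_iff_singleton.2 fun k => ?_
  -- Including the null point `0` makes the first cell half-open like the others.
  rw [Measure.restrict_congr_set Ioi_ae_eq_Ici,
    Measure.map_apply (measurable_cellIdx μ) (measurableSet_singleton k),
    Measure.restrict_apply (measurable_cellIdx μ (measurableSet_singleton k))]
  have hset : cellIdx μ ⁻¹' {k} ∩ Set.Ici 0 = Set.Ico (((k : ℝ) - 1) * μ) (k * μ) := by
    have hk : (1 : ℝ) ≤ k := by exact_mod_cast (one_le : 1 ≤ k)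
    ext t
    simp only [Set.mem_inter_iff, Set.mem_preimage, Set.mem_singleton_iff, Set.mem_Ici, Set.mem_Ico]
    have hiff : cellIdx μ t = k ↔ ⌊t / μ⌋₊ = (k : ℕ) - 1 := by
      rw [← PNat.coe_inj, cellIdx, Nat.succPNat_coe]
      have := k.pos
      omega
    have hcast : (((k : ℕ) - 1 : ℕ) : ℝ) = (k : ℝ) - 1 := by
      rw [Nat.cast_sub k.pos, Nat.cast_one]
    constructor
    · rintro ⟨h1, h2⟩
      rw [hiff, Nat.floor_eq_iff (div_nonneg h2 hμ.le), hcast, le_div_iff₀ hμ, div_lt_iff₀ hμ] at h1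
      exact ⟨h1.1, by simpa using h1.2⟩
    · rintro ⟨h1, h2⟩
      have h3 : 0 ≤ t := le_trans (mul_nonneg (by linarith) hμ.le) h1
      refine ⟨?_, h3⟩
      rw [hiff, Nat.floor_eq_iff (div_nonneg h3 hμ.le), hcast, le_div_iff₀ hμ, div_lt_iff₀ hμ]
      exact ⟨h1, by simpa using h2⟩
  rw [hset, Real.volume_Ico, Measure.smul_apply, Measure.count_singleton, smul_eq_mul, mul_one]
  congr 1
  ring

/-- A series is the integral of a step function. -/
lemma integral_comp_cellIdx {μ : ℝ} (hμ : 0 < μ) {f : ℕ+ → ℝ} (hf : Summable f) :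
    ∫ t in Set.Ioi (0 : ℝ), f (cellIdx μ t) = μ * ∑' k, f k := by
  have hint : Integrable f Measure.count := integrable_count_iff.2 hf.norm
  rw [← integral_map (measurable_cellIdx μ).aemeasurable measurable_from_top.aestronglyMeasurable,
    map_cellIdx hμ, integral_smul_measure, integral_countable hint, ENNReal.toReal_ofReal hμ.le]
  simp [measureReal_def]

/-! ### Scaling limits of the means by dominated convergence -/

section Scaling

variable {β : ℝ} {E : ℕ+ → ℝ} {L φ D : ℝ → ℝ}

lemma tendsto_scaled_meanMass (hβE : ∀ k, 0 ≤ β * E k)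
    (hlim : ∀ t, 0 < t →
      Tendsto (fun μ => occupation β E μ (cellIdx μ t) / L μ) (𝓝[>] 0) (𝓝 (φ t)))
    (hD : IntegrableOn D (Set.Ioi 0))
    (hdom : ∀ᶠ μ in 𝓝[>] 0, ∀ t, 0 < t →
      |μ * (cellIdx μ t : ℕ) * (occupation β E μ (cellIdx μ t) / L μ)| ≤ D t) :
    Tendsto (fun μ => μ ^ 2 * meanMass β E μ / L μ) (𝓝[>] 0)
      (𝓝 (∫ t in Set.Ioi 0, t * φ t)) := by
  have h := tendsto_integral_filter_of_dominated_convergence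
    (μ := volume.restrict (Set.Ioi (0 : ℝ))) (l := 𝓝[>] (0 : ℝ)) (f := fun t => t * φ t)
    (F := fun μ t => μ * (cellIdx μ t : ℕ) * (occupation β E μ (cellIdx μ t) / L μ)) D
    (Eventually.of_forall fun μ => ?_) ?_ hD ?_
  · refine h.congr' ?_
    filter_upwards [self_mem_nhdsWithin] with μ hμ
    rw [integral_comp_cellIdx hμ
      (f := fun k : ℕ+ => μ * (k : ℕ) * (occupation β E μ k / L μ)), meanMass_eq_tsum hβE hμ,
      mul_div_assoc, sq, mul_assoc]
    · rw [← tsum_div_const, ← tsum_mul_left, ← tsum_mul_left, ← tsum_mul_left]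
      exact tsum_congr fun k => by ring
    · exact ((summable_mul_occupation hβE hμ).mul_left (μ / L μ)).congr fun k => by ring
  · have hm : Measurable fun k : ℕ+ => μ * (k : ℕ) * (occupation β E μ k / L μ) :=
      measurable_from_top
    exact (hm.comp (measurable_cellIdx μ)).aestronglyMeasurable
  · filter_upwards [hdom] with μ hμ
    exact (ae_restrict_iff' measurableSet_Ioi).2 (ae_of_all _ fun t ht => hμ t ht)
  · exact (ae_restrict_iff' measurableSet_Ioi).2 (ae_of_all _ fun t (ht : 0 < t) =>
      (tendsto_mul_cellIdx ht.le).mul (hlim t ht))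

/-- The domination is assumed for the mass density. It also serves here after division by `x`, since
only cells with $\mu k\ge x$ contribute. -/
lemma tendsto_scaled_sizeDist (hβE : ∀ k, 0 ≤ β * E k)
    (hlim : ∀ t, 0 < t →
      Tendsto (fun μ => occupation β E μ (cellIdx μ t) / L μ) (𝓝[>] 0) (𝓝 (φ t)))
    (hD : IntegrableOn D (Set.Ioi 0))
    (hdom : ∀ᶠ μ in 𝓝[>] 0, ∀ t, 0 < t →
      |μ * (cellIdx μ t : ℕ) * (occupation β E μ (cellIdx μ t) / L μ)| ≤ D t)
    {x : ℝ} (hx : 0 < x) :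
    Tendsto (fun μ => μ * (∫ p, sizeDist (x / μ) p ∂(grandCanonical β E μ)) / L μ) (𝓝[>] 0)
      (𝓝 (∫ t in Set.Ioi x, φ t)) := by
  have h := tendsto_integral_filter_of_dominated_convergence
    (μ := volume.restrict (Set.Ioi (0 : ℝ))) (l := 𝓝[>] (0 : ℝ))
    (f := fun t => (Set.Ioi x).indicator φ t)
    (F := fun μ t => (if x / μ ≤ ((cellIdx μ t : ℕ) : ℝ) then 1 else 0) *
      (occupation β E μ (cellIdx μ t) / L μ)) (fun t => D t / x)
    (Eventually.of_forall fun μ => ?_) ?_ (hD.div_const x) ?_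
  · rw [setIntegral_indicator measurableSet_Ioi, Set.Ioi_inter_Ioi, max_eq_right hx.le] at h
    refine h.congr' ?_
    filter_upwards [self_mem_nhdsWithin] with μ hμ
    rw [integral_comp_cellIdx hμ (f := fun k : ℕ+ => (if x / μ ≤ ((k : ℕ) : ℝ) then 1 else 0) *
      (occupation β E μ k / L μ)), integral_sizeDist hβE hμ, mul_div_assoc]
    · rw [← tsum_div_const]
      exact congrArg _ (tsum_congr fun k => by ring)
    · exact ((summable_sizeDist hβE hμ (x / μ)).div_const (L μ)).congr fun k => by ring
  · have hm : Measurable fun k : ℕ+ => (if x / μ ≤ ((k : ℕ) : ℝ) then 1 else 0) *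
      (occupation β E μ k / L μ) := measurable_from_top
    exact (hm.comp (measurable_cellIdx μ)).aestronglyMeasurable
  · filter_upwards [hdom, self_mem_nhdsWithin] with μ hμ hμ0
    have hμ0 : 0 < μ := hμ0
    refine (ae_restrict_iff' measurableSet_Ioi).2 (ae_of_all _ fun t ht => ?_)
    have hDt := hμ t ht
    rw [le_div_iff₀ hx, Real.norm_eq_abs]
    split_ifs with hk
    · rw [div_le_iff₀' hμ0] at hk
      rw [abs_mul, abs_of_pos (hx.trans_le hk)] at hDt
      rw [one_mul, mul_comm]
      exact (mul_le_mul_of_nonneg_right hk (abs_nonneg _)).trans hDt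
    · simpa using (abs_nonneg _).trans hDt
  -- At `t = x` the indicator need not converge to the required value; that point is null.
  · have hne : ∀ᵐ t : ℝ ∂(volume.restrict (Set.Ioi 0)), t ≠ x :=
      ae_restrict_of_ae (Measure.ae_ne volume x)
    filter_upwards [hne, (ae_restrict_mem measurableSet_Ioi : ∀ᵐ t : ℝ ∂(volume.restrict _), _)]
      with t htx ht
    have ht : 0 < t := ht
    rcases lt_or_gt_of_ne htx with h | h
    · rw [Set.indicator_of_notMem (by simpa using h.le)]
      refine tendsto_const_nhds.congr' ?_
      filter_upwards [(tendsto_mul_cellIdx ht.le).eventually_lt_const h, self_mem_nhdsWithin]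
        with μ hμ hμ0
      have hμ0 : 0 < μ := hμ0
      rw [if_neg, zero_mul]
      rw [not_le, lt_div_iff₀' hμ0]
      exact hμ
    · rw [Set.indicator_of_mem (by simpa using h)]
      refine (hlim t ht).congr' ?_
      filter_upwards [self_mem_nhdsWithin] with μ hμ0
      have hμ0 : 0 < μ := hμ0
      rw [if_pos, one_mul]
      rw [div_le_iff₀' hμ0]
      exact (h.trans (lt_mul_cellIdx hμ0 t)).le

/-- Limit shapes from a scaling limit `φ`, with scale `L`, of the mean occupation numbers. -/
theorem isLimitShape_of_scaling (hβE : ∀ k, 0 ≤ β * E k) (hL : ∀ᶠ μ in 𝓝[>] 0, 0 < L μ)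
    (hμL : Tendsto (fun μ => μ / L μ) (𝓝[>] 0) (𝓝 0))
    (hlim : ∀ t, 0 < t →
      Tendsto (fun μ => occupation β E μ (cellIdx μ t) / L μ) (𝓝[>] 0) (𝓝 (φ t)))
    (hD : IntegrableOn D (Set.Ioi 0))
    (hdom : ∀ᶠ μ in 𝓝[>] 0, ∀ t, 0 < t →
      |μ * (cellIdx μ t : ℕ) * (occupation β E μ (cellIdx μ t) / L μ)| ≤ D t)
    {N : ℝ} (hN : ∫ t in Set.Ioi 0, t * φ t = N) (hN0 : 0 < N)
    {F : ℝ → ℝ} (hF : ∀ x, 0 < x → F x = (∫ t in Set.Ioi x, φ t) / N) :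
    IsLimitShape β E F ∧ cellHeight β E ~[𝓝[>] 0] fun μ => μ / (L μ * N) := by
  have hmass := tendsto_scaled_meanMass hβE hlim hD hdom
  rw [hN] at hmass
  have hratio : Tendsto (fun μ => L μ / (μ ^ 2 * meanMass β E μ)) (𝓝[>] 0) (𝓝 N⁻¹) := by
    simpa using hmass.inv₀ hN0.ne'
  have hh : Tendsto (cellHeight β E) (𝓝[>] 0) (𝓝 0) := by
    have := hμL.mul hratio
    rw [zero_mul] at this
    refine this.congr' ?_
    filter_upwards [self_mem_nhdsWithin, hL] with μ hμ hLμ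
    have hμ : 0 < μ := hμ
    have := meanMass_pos hβE hμ
    rw [cellHeight]
    field_simp
  have hmean : IsMeanLimit β E F := by
    intro x hx
    have := (tendsto_scaled_sizeDist hβE hlim hD hdom hx).mul hratio
    rw [hF x hx, div_eq_mul_inv]
    refine this.congr' ?_
    filter_upwards [self_mem_nhdsWithin, hL] with μ hμ hLμ
    have hμ : 0 < μ := hμ
    have := meanMass_pos hβE hμ
    rw [scaledDist_eq, integral_const_mul, cellHeight]
    field_simp
  -- Measurability and integrability of `φ` are inherited from the approximating step functions and
  -- the dominating function.
  have hφm : AEStronglyMeasurable φ (volume.restrict (Set.Ioi 0)) := by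
    refine aestronglyMeasurable_of_tendsto_ae (𝓝[>] (0 : ℝ))
      (f := fun μ t => occupation β E μ (cellIdx μ t) / L μ) (fun μ => ?_)
      ((ae_restrict_iff' measurableSet_Ioi).2 (ae_of_all _ hlim))
    have hm : Measurable fun k : ℕ+ => occupation β E μ k / L μ := measurable_from_top
    exact (hm.comp (measurable_cellIdx μ)).aestronglyMeasurable
  have hφD : ∀ t, 0 < t → t * |φ t| ≤ D t := fun t ht => by
    have h := ((tendsto_mul_cellIdx ht.le).mul (hlim t ht)).abs
    rw [abs_mul, abs_of_pos ht] at h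
    refine le_of_tendsto h ?_
    filter_upwards [hdom] with μ hμ using hμ t ht
  have hφi : ∀ x, 0 < x → IntegrableOn φ (Set.Ioi x) := fun x hx => by
    have hsub : Set.Ioi x ⊆ Set.Ioi 0 := Set.Ioi_subset_Ioi hx.le
    refine ((hD.mono_set hsub).div_const x).mono' (hφm.mono_set hsub) ?_
    refine (ae_restrict_iff' measurableSet_Ioi).2 (ae_of_all _ fun t (ht : x < t) => ?_)
    rw [le_div_iff₀ hx, Real.norm_eq_abs, mul_comm]
    exact (mul_le_mul_of_nonneg_right ht.le (abs_nonneg _)).trans (hφD t (hx.trans ht))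
  refine ⟨hmean.isLimitShape hβE hh ?_ ?_, ?_⟩
  · intro x hx
    have hx : 0 < x := hx
    have hc := ((hφi (x / 2) (half_pos hx)).continuousOn_Ici_primitive_Ioi).div_const N
    have hc' := hc.continuousAt (Ici_mem_nhds (half_lt_self hx))
    refine (hc'.congr ?_).continuousWithinAt
    filter_upwards [Ioi_mem_nhds hx] with z hz using (hF z hz).symm
  · have h1 := intervalIntegral_tendsto_integral_Ioi 1 (hφi 1 one_pos) tendsto_id
    have h2 := ((tendsto_const_nhds (x := ∫ t in Set.Ioi (1 : ℝ), φ t)).sub h1).div_const N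
    rw [sub_self, zero_div] at h2
    refine h2.congr' ?_
    filter_upwards [eventually_ge_atTop 1] with x hx
    rw [hF x (by linarith), id, ← intervalIntegral.integral_Ioi_sub_Ioi (hφi 1 one_pos) hx, sub_sub_cancel]
  · refine isEquivalent_of_tendsto_one ?_
    have := hratio.mul_const N
    rw [inv_mul_cancel₀ hN0.ne'] at this
    refine this.congr' ?_
    filter_upwards [self_mem_nhdsWithin, hL] with μ hμ hLμ
    have hμ : 0 < μ := hμ
    have := meanMass_pos hβE hμ
    simp only [Pi.div_apply, cellHeight]
    field_simp

end Scaling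

/-! ### Asymptotics of the energies -/

section Potential

variable {u : ℝ → ℝ} {σ : ℝ}

/-- Mean value inequality for $u(x)-\sigma x$, whose derivative tends to `0`. Taking `X > 0` keeps
the points interior to `[0, ∞)`. -/
lemma AdmissiblePotential.abs_sub_sub_le (hu : AdmissiblePotential u)
    (hσ : Tendsto (deriv u) atTop (𝓝 σ)) {δ : ℝ} (hδ : 0 < δ) :
    ∃ X : ℝ, 0 < X ∧ ∀ a b, X ≤ a → X ≤ b → |u a - u b - σ * (a - b)| ≤ δ * |a - b| := by
  obtain ⟨X, hX⟩ := eventually_atTop.1 ((hσ.eventually (Metric.ball_mem_nhds σ hδ)).and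
    (eventually_gt_atTop 0))
  refine ⟨X, (hX X le_rfl).2, fun a b ha hb => ?_⟩
  have hd : ∀ x ∈ Set.Ici X, DifferentiableAt ℝ u x := fun x hx =>
    hu.differentiableOn.differentiableAt (Ici_mem_nhds (hX x hx).2)
  have h := (convex_Ici X).norm_image_sub_le_of_norm_deriv_le (𝕜 := ℝ)
    (f := fun x => u x - σ * x) (C := δ) (x := b) (y := a)
    (fun x hx => (hd x hx).sub (differentiableAt_fun_id.const_mul σ)) (fun x hx => ?_) hb ha
  · rw [Real.norm_eq_abs, Real.norm_eq_abs] at h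
    convert h using 2
    ring
  · rw [deriv_fun_sub (hd x hx) (differentiableAt_fun_id.const_mul σ),
      deriv_const_mul σ differentiableAt_fun_id]
    have := (hX x hx).1
    rw [Real.dist_eq] at this
    simpa using this.le

/-- A version valid down to `0`, needed for domination uniform in `t`. Replacing each argument by
its maximum with `X` costs at most `2 * K`, where `K` bounds $u(x)-\sigma x$ on `[0, X]`. -/
lemma AdmissiblePotential.abs_sub_sub_le_add (hu : AdmissiblePotential u)
    (hσ : Tendsto (deriv u) atTop (𝓝 σ)) {δ : ℝ} (hδ : 0 < δ) :
    ∃ C : ℝ, ∀ a b, 0 ≤ a → 0 ≤ b → |u a - u b - σ * (a - b)| ≤ C + δ * |a - b| := by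
  obtain ⟨X, hX0, hX⟩ := hu.abs_sub_sub_le hσ hδ
  have hc : ContinuousOn (fun x => u x - σ * x) (Set.Icc 0 X) :=
    (hu.differentiableOn.continuousOn.mono Set.Icc_subset_Ici_self).sub (by fun_prop)
  obtain ⟨K, hK⟩ := isCompact_Icc.exists_bound_of_continuousOn hc
  have hK0 : 0 ≤ K := (norm_nonneg _).trans (hK X ⟨hX0.le, le_rfl⟩)
  have hcut : ∀ a, 0 ≤ a → |(u a - σ * a) - (u (max a X) - σ * max a X)| ≤ 2 * K := by
    intro a ha
    rcases le_total X a with h | h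
    · rw [max_eq_left h, sub_self, abs_zero]
      positivity
    · rw [max_eq_right h]
      have h1 := hK a ⟨ha, h⟩
      have h2 := hK X ⟨hX0.le, le_rfl⟩
      rw [Real.norm_eq_abs] at h1 h2
      linarith [abs_sub (u a - σ * a) (u X - σ * X)]
  refine ⟨4 * K, fun a b ha hb => ?_⟩
  have h1 := abs_le.1 (hcut a ha)
  have h2 := abs_le.1 (hcut b hb)
  have h3 := hX (max a X) (max b X) (le_max_right _ _) (le_max_right _ _)
  have h4 := abs_le.1 (h3.trans
    (mul_le_mul_of_nonneg_left (abs_max_sub_max_le_abs a b X) hδ.le))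
  rw [abs_le]
  constructor <;> linarith

lemma AdmissiblePotential.isLittleO_sub_mul (hu : AdmissiblePotential u)
    (hσ : Tendsto (deriv u) atTop (𝓝 σ)) :
    (fun a => u a - σ * a) =o[atTop] fun a : ℝ => a := by
  refine isLittleO_iff.2 fun c hc => ?_
  obtain ⟨C, hC⟩ := hu.abs_sub_sub_le_add hσ (half_pos hc)
  filter_upwards [eventually_ge_atTop 0, eventually_ge_atTop ((C + |u 0|) / (c / 2))]
    with a ha ha'
  have h1 := hC a 0 ha le_rfl
  rw [div_le_iff₀ (half_pos hc)] at ha'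
  rw [sub_zero, abs_of_nonneg ha] at h1
  rw [Real.norm_eq_abs, Real.norm_eq_abs, abs_of_nonneg ha]
  have h2 := abs_le.1 h1
  have h3 := abs_le.1 (le_refl |u 0|)
  rw [abs_le]
  constructor <;> linarith

lemma tendsto_log_pnat : Tendsto (fun k : ℕ+ => Real.log (k : ℝ)) atTop atTop := by
  refine Real.tendsto_log_atTop.comp (tendsto_natCast_atTop_atTop.comp ?_)
  exact tendsto_atTop.2 fun n => by
    filter_upwards [eventually_ge_atTop (Nat.succPNat n)] with k hk
    have : n + 1 ≤ (k : ℕ) := hk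
    omega

lemma eq_zero_of_isLittleO_log {c : ℝ}
    (h : (fun k : ℕ+ => c * Real.log (k : ℝ)) =o[atTop] fun k : ℕ+ => Real.log (k : ℝ)) :
    c = 0 := by
  by_contra hc
  refine isLittleO_irrefl ?_ ((isLittleO_const_mul_left_iff hc).1 h)
  exact (tendsto_log_pnat.eventually_ne_atTop 0).frequently

/-- Both $E_k$ and $E_k-\sigma\ln k$ are $o(\ln k)$, hence so is $\sigma\ln k$. -/
lemma AdmissiblePotential.deriv_lim_of_subLogarithmic (hu : AdmissiblePotential u)
    (hσ : Tendsto (deriv u) atTop (𝓝 σ)) (h : SubLogarithmic (energy u)) : σ = 0 := by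
  have h1 := (hu.isLittleO_sub_mul hσ).comp_tendsto tendsto_log_pnat
  refine eq_zero_of_isLittleO_log ((h.sub h1).congr_left fun k => ?_)
  simp [energy]

lemma AdmissiblePotential.deriv_lim_of_logarithmic (hu : AdmissiblePotential u)
    (hσ : Tendsto (deriv u) atTop (𝓝 σ)) (h : Logarithmic (energy u)) : σ = 1 := by
  have h1 := (hu.isLittleO_sub_mul hσ).comp_tendsto tendsto_log_pnat
  refine sub_eq_zero.1 (eq_zero_of_isLittleO_log ((h.isLittleO.sub h1).congr_left fun k => ?_))
  simp [energy]
  ring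

lemma Logarithmic.tendsto_atTop {E : ℕ+ → ℝ} (h : Logarithmic E) : Tendsto E atTop atTop :=
  h.symm.tendsto_atTop tendsto_log_pnat

lemma log_cellIdx_sub {μ : ℝ} (hμ : 0 < μ) (t : ℝ) :
    Real.log (cellIdx μ t : ℕ) - Real.log (1 / μ) = Real.log (μ * (cellIdx μ t : ℕ)) := by
  have hk : ((cellIdx μ t : ℕ) : ℝ) ≠ 0 := by exact_mod_cast (cellIdx μ t).ne_zero
  rw [Real.log_mul hμ.ne' hk, one_div, Real.log_inv]
  ring

lemma tendsto_log_one_div : Tendsto (fun μ : ℝ => Real.log (1 / μ)) (𝓝[>] 0) atTop := by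
  simp_rw [one_div]
  exact Real.tendsto_log_atTop.comp tendsto_inv_nhdsGT_zero

lemma tendsto_log_mul_cellIdx {t : ℝ} (ht : 0 < t) :
    Tendsto (fun μ : ℝ => Real.log (μ * (cellIdx μ t : ℕ))) (𝓝[>] 0) (𝓝 (Real.log t)) :=
  (tendsto_mul_cellIdx ht.le).log ht.ne'

/-- The two arguments of `u` differ by $\ln(\mu k)\to\ln t$, a bounded shift far out, where `u` is
nearly affine with slope `σ`. So $e^{-\beta E_k}$ varies regularly with index $-\beta\sigma$. -/
lemma AdmissiblePotential.tendsto_energy_sub (hu : AdmissiblePotential u)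
    (hσ : Tendsto (deriv u) atTop (𝓝 σ)) {t : ℝ} (ht : 0 < t) :
    Tendsto (fun μ : ℝ => energy u (cellIdx μ t) - u (Real.log (1 / μ))) (𝓝[>] 0)
      (𝓝 (σ * Real.log t)) := by
  have hlog := tendsto_log_mul_cellIdx ht
  have hsmall : (fun μ : ℝ => energy u (cellIdx μ t) - u (Real.log (1 / μ)) -
      σ * Real.log (μ * (cellIdx μ t : ℕ))) =o[𝓝[>] 0]
      fun μ : ℝ => Real.log (μ * (cellIdx μ t : ℕ)) := by
    refine isLittleO_iff.2 fun δ hδ => ?_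
    obtain ⟨X, -, hX⟩ := hu.abs_sub_sub_le hσ hδ
    filter_upwards [self_mem_nhdsWithin, tendsto_log_one_div.eventually_ge_atTop X,
      (tendsto_log_pnat.comp (tendsto_cellIdx ht)).eventually_ge_atTop X] with μ hμ h1 h2
    rw [← log_cellIdx_sub hμ]
    exact hX _ _ h2 h1
  have h0 := (isLittleO_one_iff ℝ).1 (hsmall.trans_isBigO (hlog.isBigO_one ℝ))
  simpa using h0.add (hlog.const_mul σ)

end Potential

/-! ### Domination and energies growing to infinity -/

/-- `s / (e^s - 1) ≤ e^{-s/2}`. -/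
lemma mul_exp_neg_div_le {s : ℝ} (hs : 0 < s) :
    s * (Real.exp (-s) / (1 - Real.exp (-s))) ≤ Real.exp (-(s / 2)) := by
  have h1 : 0 < 1 - Real.exp (-s) := sub_pos.2 (Real.exp_lt_one_iff.2 (by linarith))
  rw [← mul_div_assoc, div_le_iff₀ h1]
  -- After clearing denominators the claim is exactly $s\le 2\sinh(s/2)$.
  have h2 : s / 2 ≤ Real.sinh (s / 2) := Real.self_le_sinh_iff.2 (by linarith)
  rw [Real.sinh_eq] at h2
  have h3 : Real.exp (-s) = Real.exp (-(s / 2)) * Real.exp (-(s / 2)) := by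
    rw [← Real.exp_add]
    congr 1
    ring
  have h4 : Real.exp (s / 2) * Real.exp (-(s / 2)) = 1 := by
    rw [← Real.exp_add]
    simp
  have h5 := Real.exp_pos (-(s / 2))
  rw [h3]
  nlinarith [mul_le_mul_of_nonneg_left h2 (mul_nonneg h5.le h5.le)]

/-- Replacing $1-q_k$ by the smaller $1-e^{-\mu k}$ lets the energy factor split off; the rest is
$s/(e^s-1)$ at $s=\mu k$. -/
lemma mul_occupation_le {β : ℝ} {E : ℕ+ → ℝ} {μ : ℝ} (hβE : ∀ k, 0 ≤ β * E k) (hμ : 0 < μ)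
    (k : ℕ+) :
    μ * (k : ℕ) * occupation β E μ k ≤
      Real.exp (-(β * E k)) * Real.exp (-(μ * (k : ℕ) / 2)) := by
  have hk : (0 : ℝ) < k := by exact_mod_cast k.pos
  have hs : 0 < μ * k := mul_pos hμ hk
  have h1 : 0 < 1 - Real.exp (-(μ * k)) := sub_pos.2 (Real.exp_lt_one_iff.2 (by linarith))
  have hb : boltzmann β E μ k = Real.exp (-(β * E k)) * Real.exp (-(μ * k)) := by
    rw [boltzmann, ← Real.exp_add]
    rfl
  have h2 : occupation β E μ k ≤
      Real.exp (-(β * E k)) * (Real.exp (-(μ * k)) / (1 - Real.exp (-(μ * k)))) := by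
    rw [occupation, ← mul_div_assoc, ← hb]
    exact div_le_div_of_nonneg_left (boltzmann_pos k).le h1
      (by linarith [boltzmann_le_exp (μ := μ) hβE k])
  calc μ * k * occupation β E μ k
      ≤ μ * k * (Real.exp (-(β * E k)) * (Real.exp (-(μ * k)) / (1 - Real.exp (-(μ * k))))) :=
        mul_le_mul_of_nonneg_left h2 hs.le
    _ = Real.exp (-(β * E k)) *
        (μ * k * (Real.exp (-(μ * k)) / (1 - Real.exp (-(μ * k))))) := by ring
    _ ≤ _ := mul_le_mul_of_nonneg_left (mul_exp_neg_div_le hs) (Real.exp_pos _).le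

lemma integrableOn_rpow_mul_exp_neg_mul {a r : ℝ} (ha : -1 < a) (hr : 0 < r) :
    IntegrableOn (fun t : ℝ => t ^ a * Real.exp (-(r * t))) (Set.Ioi 0) := by
  simpa using integrableOn_rpow_mul_exp_neg_mul_rpow ha one_pos hr

section Growing

/-- The first factor is $\max(s^\eta,s^{-\eta})$. Since $2\eta\le1$, it is at most $s^{-\eta}(2+s)$,
and half of the exponential decay absorbs $2+s$. -/
lemma exp_mul_abs_log_mul_exp_le {η s : ℝ} (hη : 2 * η ≤ 1) (hs : 0 < s) :
    Real.exp (η * |Real.log s|) * Real.exp (-(s / 2)) ≤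
      4 * (s ^ (-η) * Real.exp (-(1 / 4 * s))) := by
  have h1 : Real.exp (η * |Real.log s|) ≤ s ^ (-η) * (2 + s) := by
    have hpos : 0 < s ^ (-η) := Real.rpow_pos_of_pos hs _
    rcases le_total s 1 with h | h
    · rw [abs_of_nonpos (Real.log_nonpos hs.le h), mul_neg, ← neg_mul, mul_comm,
        ← Real.rpow_def_of_pos hs]
      nlinarith
    · rw [abs_of_nonneg (Real.log_nonneg h), mul_comm, ← Real.rpow_def_of_pos hs]
      have h2 : s ^ (2 * η) ≤ s := by
        simpa using Real.rpow_le_rpow_of_exponent_le h hη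
      calc s ^ η = s ^ (-η) * s ^ (2 * η) := by
            rw [← Real.rpow_add hs]
            congr 1
            ring
        _ ≤ _ := mul_le_mul_of_nonneg_left (by linarith) hpos.le
  have h2 : 2 + s ≤ 4 * Real.exp (1 / 4 * s) := by linarith [Real.add_one_le_exp (1 / 4 * s)]
  calc Real.exp (η * |Real.log s|) * Real.exp (-(s / 2))
      ≤ s ^ (-η) * (2 + s) * Real.exp (-(s / 2)) :=
        mul_le_mul_of_nonneg_right h1 (Real.exp_pos _).le
    _ ≤ s ^ (-η) * (4 * Real.exp (1 / 4 * s)) * Real.exp (-(s / 2)) := by gcongr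
    _ = 4 * (s ^ (-η) * (Real.exp (1 / 4 * s) * Real.exp (-(s / 2)))) := by ring
    _ = _ := by
      rw [← Real.exp_add]
      congr 3
      ring

variable {u : ℝ → ℝ} {σ β : ℝ}

/-- The limit shape for energies growing to infinity, with `σ = lim u'`. -/
theorem isLimitShape_of_tendsto_atTop (hu : AdmissiblePotential u)
    (hσ : Tendsto (deriv u) atTop (𝓝 σ)) (hσ0 : 0 ≤ σ) (hβ : 0 < β) (hβσ : β * σ < 1)
    (hE : Tendsto (energy u) atTop atTop) {F : ℝ → ℝ}
    (hF : ∀ x, 0 < x → F x =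
      (∫ t in Set.Ioi x, t ^ (-(β * σ)) * Real.exp (-t)) / Real.Gamma (2 - β * σ)) :
    IsLimitShape β (energy u) F ∧ cellHeight β (energy u) ~[𝓝[>] 0]
      fun μ => μ * Real.exp (β * u (Real.log (1 / μ))) / Real.Gamma (2 - β * σ) := by
  have hlog0 : ∀ k : ℕ+, 0 ≤ Real.log (k : ℝ) := fun k => Real.log_natCast_nonneg _
  have hβE : ∀ k, 0 ≤ β * energy u k := fun k =>
    mul_nonneg hβ.le (hu.pos _ (hlog0 k)).le
  have hβσ0 : 0 ≤ β * σ := mul_nonneg hβ.le hσ0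
  -- Half the gap to criticality: $-\beta\sigma-\eta>-1$ keeps the dominating function integrable,
  -- and $\beta u(b)\le(1-\eta)b$ eventually.
  set η := (1 - β * σ) / 2 with hη
  have hη0 : 0 < η := by linarith
  -- With slope error `η / β`, multiplication by `β` leaves $\eta\,|\ln s|$ in the exponent.
  obtain ⟨C, hC⟩ := hu.abs_sub_sub_le_add hσ (div_pos hη0 hβ)
  have hG : 0 < Real.Gamma (2 - β * σ) := Real.Gamma_pos_of_pos (by linarith)
  have key := isLimitShape_of_scaling (β := β) (E := energy u)
    (L := fun μ => Real.exp (-(β * u (Real.log (1 / μ)))))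
    (φ := fun t => t ^ (-(β * σ)) * Real.exp (-t))
    (D := fun t => 4 * Real.exp (β * C) * (t ^ (-(β * σ) - η) * Real.exp (-(1 / 4 * t))))
    hβE (Eventually.of_forall fun _ => Real.exp_pos _) ?_ ?_ ?_ ?_ (N := Real.Gamma (2 - β * σ))
    ?_ hG hF
  · refine ⟨key.1, key.2.trans (EventuallyEq.isEquivalent (Eventually.of_forall fun μ => ?_))⟩
    simp only [Real.exp_neg]
    field_simp
  -- With $b=\ln(1/\mu)$, the ratio $\mu/L$ equals $e^{-(b-\beta u(b))}$.
  · have h1 : Tendsto (fun b : ℝ => b - β * u b) atTop atTop := by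
      refine tendsto_atTop_mono' _ ?_ (tendsto_id.const_mul_atTop hη0)
      filter_upwards [(isLittleO_iff.1 (hu.isLittleO_sub_mul hσ)) (div_pos hη0 hβ),
        eventually_ge_atTop 0] with b hb hb0
      rw [Real.norm_eq_abs, Real.norm_eq_abs, abs_of_nonneg hb0] at hb
      have h2 := mul_le_mul_of_nonneg_left (abs_le.1 hb).2 hβ.le
      have h3 : β * (η / β * b) = η * b := by field_simp
      rw [h3] at h2
      have h4 : 2 * η = 1 - β * σ := by rw [hη]; ring
      show η * b ≤ b - β * u b
      nlinarith
    have h2 := Real.tendsto_exp_neg_atTop_nhds_zero.comp (h1.comp tendsto_log_one_div)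
    refine h2.congr' ?_
    filter_upwards [self_mem_nhdsWithin] with μ hμ
    have hμ : 0 < μ := hμ
    simp only [Function.comp]
    rw [neg_sub, Real.exp_sub, Real.exp_log (one_div_pos.2 hμ), Real.exp_neg]
    field_simp
  · intro t ht
    -- Growing energies send $q_k$ to `0`, so the denominator $1-q_k$ drops out: Bose statistics
    -- become Maxwell–Boltzmann.
    have hq0 : Tendsto (fun μ => boltzmann β (energy u) μ (cellIdx μ t)) (𝓝[>] 0) (𝓝 0) := by
      have h1 := Real.tendsto_exp_neg_atTop_nhds_zero.comp
        ((hE.comp (tendsto_cellIdx ht)).const_mul_atTop hβ)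
      refine tendsto_of_tendsto_of_tendsto_of_le_of_le' tendsto_const_nhds h1
        (Eventually.of_forall fun μ => (boltzmann_pos _).le) ?_
      filter_upwards [self_mem_nhdsWithin] with μ hμ
      have : 0 ≤ μ * ((cellIdx μ t : ℕ) : ℝ) := mul_nonneg (le_of_lt hμ) (Nat.cast_nonneg _)
      exact Real.exp_le_exp.2 (by simpa using this)
    have hqL : Tendsto (fun μ => Real.exp (-(β * (energy u (cellIdx μ t) -
        u (Real.log (1 / μ)))) - μ * (cellIdx μ t : ℕ))) (𝓝[>] 0)
        (𝓝 (Real.exp (-(β * (σ * Real.log t)) - t))) :=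
      (Real.continuous_exp.tendsto _).comp
        ((((hu.tendsto_energy_sub hσ ht).const_mul β).neg).sub (tendsto_mul_cellIdx ht.le))
    have h := hqL.div (hq0.const_sub 1) (by norm_num)
    have hval : t ^ (-(β * σ)) * Real.exp (-t) =
        Real.exp (-(β * (σ * Real.log t)) - t) / (1 - 0) := by
      rw [Real.rpow_def_of_pos ht, ← Real.exp_add, sub_zero, div_one]
      congr 1
      ring
    rw [hval]
    refine h.congr fun μ => ?_
    simp only [Pi.div_apply]
    rw [occupation, div_right_comm]
    congr 1
    rw [boltzmann, ← Real.exp_sub]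
    congr 1
    ring
  · exact (integrableOn_rpow_mul_exp_neg_mul (by linarith) (by norm_num)).const_mul _
  · have hlt1 : ∀ᶠ μ : ℝ in 𝓝[>] 0, μ < 1 :=
      mem_of_superset (Ioo_mem_nhdsGT one_pos) fun _ h => h.2
    filter_upwards [self_mem_nhdsWithin, hlt1] with μ hμ hμ1 t ht
    have hμ : 0 < μ := hμ
    set k := cellIdx μ t with hk
    have hts : t < μ * (k : ℕ) := lt_mul_cellIdx hμ t
    set s := μ * ((k : ℕ) : ℝ) with hs
    have hs0 : 0 < s := ht.trans hts
    have hocc := mul_occupation_le hβE hμ k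
    have hb0 : 0 ≤ Real.log (1 / μ) := Real.log_nonneg ((one_le_div hμ).2 hμ1.le)
    have hC' := (abs_le.1 (hC _ _ (hlog0 k) hb0)).1
    rw [log_cellIdx_sub hμ] at hC'
    rw [abs_of_nonneg (mul_nonneg hs0.le (div_nonneg (occupation_pos hβE hμ k).le
      (Real.exp_pos _).le)), ← mul_div_assoc, div_le_iff₀ (Real.exp_pos _)]
    have hexp : Real.exp (-(β * energy u k)) ≤ Real.exp (β * C) *
        (s ^ (-(β * σ)) * Real.exp (η * |Real.log s|)) *
        Real.exp (-(β * u (Real.log (1 / μ)))) := by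
      rw [Real.rpow_def_of_pos hs0, ← Real.exp_add, ← Real.exp_add, ← Real.exp_add]
      refine Real.exp_le_exp.2 ?_
      have h1 := mul_le_mul_of_nonneg_left hC' hβ.le
      have h2 : β * -(C + η / β * |Real.log s|) = -(β * C) - η * |Real.log s| := by
        field_simp
        ring
      rw [h2] at h1
      change _ ≤ β * (energy u k - u (Real.log (1 / μ)) - σ * Real.log s) at h1
      linarith
    -- Both factors decrease and $t<s=\mu k$, so the bound can be moved to `t`, where it no longer
    -- depends on `μ`.
    have hmono : s ^ (-(β * σ) - η) * Real.exp (-(1 / 4 * s)) ≤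
        t ^ (-(β * σ) - η) * Real.exp (-(1 / 4 * t)) :=
      mul_le_mul (Real.rpow_le_rpow_of_nonpos ht hts.le (by linarith))
        (Real.exp_le_exp.2 (by linarith)) (Real.exp_pos _).le (Real.rpow_nonneg ht.le _)
    calc s * occupation β (energy u) μ k
        ≤ Real.exp (-(β * energy u k)) * Real.exp (-(s / 2)) := hocc
      _ ≤ Real.exp (β * C) * (s ^ (-(β * σ)) * Real.exp (η * |Real.log s|)) *
          Real.exp (-(β * u (Real.log (1 / μ)))) * Real.exp (-(s / 2)) :=
          mul_le_mul_of_nonneg_right hexp (Real.exp_pos _).le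
      _ = Real.exp (β * C) * Real.exp (-(β * u (Real.log (1 / μ)))) * s ^ (-(β * σ)) *
          (Real.exp (η * |Real.log s|) * Real.exp (-(s / 2))) := by ring
      _ ≤ Real.exp (β * C) * Real.exp (-(β * u (Real.log (1 / μ)))) * s ^ (-(β * σ)) *
          (4 * (s ^ (-η) * Real.exp (-(1 / 4 * s)))) :=
          mul_le_mul_of_nonneg_left
            (exp_mul_abs_log_mul_exp_le (by linarith) hs0) (by positivity)
      _ = 4 * Real.exp (β * C) * (s ^ (-(β * σ) - η) * Real.exp (-(1 / 4 * s))) *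
          Real.exp (-(β * u (Real.log (1 / μ)))) := by
          rw [sub_eq_add_neg, Real.rpow_add hs0]
          ring
      _ ≤ _ := by gcongr
  · rw [Real.Gamma_eq_integral (by linarith)]
    refine setIntegral_congr_fun measurableSet_Ioi fun t (ht : 0 < t) => ?_
    have : (2 : ℝ) - β * σ - 1 = 1 + -(β * σ) := by ring
    rw [this, Real.rpow_add ht, Real.rpow_one]
    ring

end Growing

/-! ### Bose–Einstein integrals and asymptotically constant energies -/

lemma integral_Ioi_exp_div_one_sub_exp {b x : ℝ} (hbx : 0 < b + x) :
    ∫ t in Set.Ioi x, Real.exp (-b - t) / (1 - Real.exp (-b - t)) =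
      -Real.log (1 - Real.exp (-b - x)) := by
  have hpos : ∀ t, x ≤ t → 0 < 1 - Real.exp (-b - t) := fun t ht =>
    sub_pos.2 (Real.exp_lt_one_iff.2 (by linarith))
  have hderiv : ∀ t, x ≤ t → HasDerivAt (fun t => Real.log (1 - Real.exp (-b - t)))
      (Real.exp (-b - t) / (1 - Real.exp (-b - t))) t := fun t ht => by
    have h := ((((hasDerivAt_id t).const_sub (-b)).exp).const_sub 1).log (hpos t ht).ne'
    simpa using h
  have hlim : Tendsto (fun t => Real.log (1 - Real.exp (-b - t))) atTop (𝓝 0) := by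
    have h1 : Tendsto (fun t : ℝ => 1 - Real.exp (-b - t)) atTop (𝓝 1) := by
      have h2 : Tendsto (fun t : ℝ => -b - t) atTop atBot :=
        tendsto_atBot_add_const_left _ _ tendsto_neg_atTop_atBot
      simpa using (Real.tendsto_exp_atBot.comp h2).const_sub 1
    simpa using h1.log one_ne_zero
  rw [integral_Ioi_of_hasDerivAt_of_nonneg
    (g := fun t => Real.log (1 - Real.exp (-b - t))) (l := 0)
    (hderiv x le_rfl).continuousAt.continuousWithinAt (fun t ht => hderiv t (le_of_lt ht))
    (fun t ht => div_nonneg (Real.exp_pos _).le (hpos t (le_of_lt ht)).le) hlim, zero_sub]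

lemma integral_mul_exp_neg_mul {r : ℝ} (hr : 0 < r) :
    ∫ t in Set.Ioi (0 : ℝ), t * Real.exp (-(r * t)) = 1 / r ^ 2 := by
  have h := Real.integral_rpow_mul_exp_neg_mul_Ioi (a := 2) two_pos hr
  rw [Real.Gamma_two, mul_one] at h
  norm_num at h
  simpa using h

/-- Expand the geometric series and integrate termwise: with $m=n+1$, the term $e^{-mb}\,t\,e^{-mt}$
contributes $e^{-mb}/m^2$. -/
lemma integral_mul_exp_div_one_sub_exp {b : ℝ} (hb : 0 ≤ b) :
    ∫ t in Set.Ioi (0 : ℝ), t * (Real.exp (-b - t) / (1 - Real.exp (-b - t))) =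
      dilog (Real.exp (-b)) := by
  have hr : ∀ n : ℕ, (0 : ℝ) < n + 1 := fun n => n.cast_add_one_pos
  have hint : ∀ n : ℕ, ∫ t in Set.Ioi (0 : ℝ),
      Real.exp (-b) ^ (n + 1) * (t * Real.exp (-(((n : ℝ) + 1) * t))) =
      Real.exp (-b) ^ (n + 1) / ((n : ℝ) + 1) ^ 2 := fun n => by
    rw [integral_const_mul, integral_mul_exp_neg_mul (hr n), mul_one_div]
  have hnorm : ∀ n : ℕ, ∫ t in Set.Ioi (0 : ℝ),
      ‖Real.exp (-b) ^ (n + 1) * (t * Real.exp (-(((n : ℝ) + 1) * t)))‖ =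
      Real.exp (-b) ^ (n + 1) / ((n : ℝ) + 1) ^ 2 := fun n => by
    rw [← hint n]
    refine setIntegral_congr_fun measurableSet_Ioi fun t (ht : 0 < t) => ?_
    exact Real.norm_of_nonneg (by positivity)
  have h := hasSum_integral_of_summable_integral_norm
    (μ := volume.restrict (Set.Ioi (0 : ℝ)))
    (F := fun (n : ℕ) t => Real.exp (-b) ^ (n + 1) * (t * Real.exp (-(((n : ℝ) + 1) * t))))
    (fun n => ?_) ?_
  · simp_rw [hint] at h
    rw [dilog, h.tsum_eq]
    refine setIntegral_congr_fun measurableSet_Ioi fun t (ht : 0 < t) => ?_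
    have h0 := (Real.exp_pos (-b - t)).le
    have h1 : Real.exp (-b - t) < 1 := Real.exp_lt_one_iff.2 (by linarith)
    have hterm : ∀ n : ℕ, Real.exp (-b) ^ (n + 1) * (t * Real.exp (-(((n : ℝ) + 1) * t))) =
        t * Real.exp (-b - t) * Real.exp (-b - t) ^ n := fun n => by
      rw [mul_assoc, ← pow_succ', ← Real.exp_nat_mul, ← Real.exp_nat_mul, mul_left_comm,
        ← Real.exp_add]
      push_cast
      congr 2
      ring
    simp_rw [hterm]
    rw [tsum_mul_left, tsum_geometric_of_lt_one h0 h1, mul_div_assoc', div_eq_mul_inv]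
  · have := integrableOn_rpow_mul_exp_neg_mul (a := 1) (by norm_num) (hr n)
    simp_rw [Real.rpow_one] at this
    exact this.const_mul _
  · simp_rw [hnorm]
    refine Summable.of_nonneg_of_le (fun n => by positivity) (fun n => ?_)
      ((summable_nat_add_iff 1).2 hasSum_zeta_two.summable)
    push_cast
    gcongr
    exact pow_le_one₀ (Real.exp_pos _).le (Real.exp_le_one_iff.2 (by linarith))

lemma dilog_one : dilog 1 = Real.pi ^ 2 / 6 := by
  have h := hasSum_zeta_two
  rw [← h.tsum_eq, h.summable.tsum_eq_zero_add, dilog]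
  simp

lemma dilog_exp_neg_pos {b : ℝ} (hb : 0 ≤ b) : 0 < dilog (Real.exp (-b)) := by
  refine Summable.tsum_pos ?_ (fun n => by positivity) 0 (by positivity)
  refine Summable.of_nonneg_of_le (fun n => by positivity) (fun n => ?_)
    ((summable_nat_add_iff 1).2 hasSum_zeta_two.summable)
  push_cast
  gcongr
  exact pow_le_one₀ (Real.exp_pos _).le (Real.exp_le_one_iff.2 (by linarith))

lemma shiftedShape_zero : shiftedShape 0 = classicalShape := by
  funext x
  rw [shiftedShape, classicalShape, neg_zero, Real.exp_zero, dilog_one, zero_sub]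
  field_simp

/-- The limit shape for asymptotically constant energies, with `b = lim β E`. -/
theorem isLimitShape_of_tendsto_nhds {β : ℝ} {E : ℕ+ → ℝ} (hβE : ∀ k, 0 ≤ β * E k) {b : ℝ}
    (hb : 0 ≤ b) (hE : Tendsto (fun k => β * E k) atTop (𝓝 b)) :
    IsLimitShape β E (shiftedShape b) ∧
      cellHeight β E ~[𝓝[>] 0] fun μ => μ / dilog (Real.exp (-b)) := by
  -- No rescaling of occupations is needed. For `b = 0` the profile is singular like $1/t$ at the
  -- origin, but the domination concerns only $t\varphi(t)$.
  have key := isLimitShape_of_scaling (β := β) (E := E) (L := fun _ => 1)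
    (φ := fun t => Real.exp (-b - t) / (1 - Real.exp (-b - t)))
    (D := fun t => Real.exp (-(1 / 2 * t)))
    hβE (Eventually.of_forall fun _ => one_pos) ?_ ?_ ?_ ?_
    (integral_mul_exp_div_one_sub_exp hb) (dilog_exp_neg_pos hb) (F := shiftedShape b)
    (fun x hx => by rw [integral_Ioi_exp_div_one_sub_exp (by linarith), shiftedShape])
  · simpa using key
  · simp_rw [div_one]
    exact tendsto_id.mono_left nhdsWithin_le_nhds
  · intro t ht
    have hq : Tendsto (fun μ => boltzmann β E μ (cellIdx μ t)) (𝓝[>] 0)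
        (𝓝 (Real.exp (-b - t))) :=
      (Real.continuous_exp.tendsto _).comp
        (((hE.comp (tendsto_cellIdx ht)).neg).sub (tendsto_mul_cellIdx ht.le))
    have h1 : Real.exp (-b - t) < 1 := Real.exp_lt_one_iff.2 (by linarith)
    simp_rw [div_one]
    exact hq.div (hq.const_sub 1) (sub_pos.2 h1).ne'
  · simpa using integrableOn_rpow_mul_exp_neg_mul (a := 0) (by norm_num) (one_half_pos (α := ℝ))
  · filter_upwards [self_mem_nhdsWithin] with μ hμ t ht
    have hμ : 0 < μ := hμ
    have hts := lt_mul_cellIdx hμ t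
    have hocc := (occupation_pos hβE hμ (cellIdx μ t)).le
    rw [div_one, abs_of_nonneg (mul_nonneg (ht.trans hts).le hocc)]
    refine (mul_occupation_le hβE hμ _).trans ?_
    calc _ ≤ 1 * Real.exp (-(1 / 2 * t)) :=
          mul_le_mul (Real.exp_le_one_iff.2 (by linarith [hβE (cellIdx μ t)]))
            (Real.exp_le_exp.2 (by linarith)) (Real.exp_pos _).le zero_le_one
      _ = _ := one_mul _

lemma isLimitShape_classical {β : ℝ} {E : ℕ+ → ℝ} (hβE : ∀ k, 0 ≤ β * E k)
    (hE : Tendsto (fun k => β * E k) atTop (𝓝 0)) :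
    IsLimitShape β E classicalShape ∧
      cellHeight β E ~[𝓝[>] 0] fun μ => 6 / Real.pi ^ 2 * μ := by
  have h := isLimitShape_of_tendsto_nhds hβE le_rfl hE
  rw [shiftedShape_zero, neg_zero, Real.exp_zero, dilog_one] at h
  refine ⟨h.1, h.2.trans (EventuallyEq.isEquivalent (Eventually.of_forall fun μ => ?_))⟩
  field_simp

/-- The hypothesis concerns integers, while $1/\mu$ is real. The integer `cellIdx μ 1` is a proxy
for it: both the energy difference and the difference of logarithms tend to `0`. -/
lemma AdmissiblePotential.isEquivalent_mul_exp {u : ℝ → ℝ} (hu : AdmissiblePotential u)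
    {σ : ℝ} (hσ : Tendsto (deriv u) atTop (𝓝 σ)) (β : ℝ)
    (h : Tendsto (fun k : ℕ+ => energy u k - Real.log (k : ℝ)) atTop (𝓝 0)) :
    (fun μ => μ * Real.exp (β * u (Real.log (1 / μ)))) ~[𝓝[>] 0] fun μ => μ ^ (1 - β) := by
  have h1 : Tendsto (fun μ : ℝ => u (Real.log (1 / μ)) - Real.log (1 / μ)) (𝓝[>] 0) (𝓝 0) := by
    have := ((h.comp (tendsto_cellIdx one_pos)).sub (hu.tendsto_energy_sub hσ one_pos)).add
      (tendsto_log_mul_cellIdx one_pos)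
    simp only [Real.log_one, mul_zero, sub_zero, add_zero] at this
    refine this.congr' ?_
    filter_upwards [self_mem_nhdsWithin] with μ hμ
    rw [← log_cellIdx_sub hμ]
    simp only [Function.comp]
    ring
  have h2 := (Real.continuous_exp.tendsto _).comp (h1.const_mul β)
  rw [mul_zero, Real.exp_zero] at h2
  refine isEquivalent_of_tendsto_one (h2.congr' ?_)
  filter_upwards [self_mem_nhdsWithin] with μ hμ
  have hμ : 0 < μ := hμ
  simp only [Function.comp, Pi.div_apply]
  have hexp : μ * Real.exp (β * u (Real.log (1 / μ))) =
      Real.exp (Real.log μ) * Real.exp (β * u (Real.log (1 / μ))) := by rw [Real.exp_log hμ]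
  rw [eq_div_iff (Real.rpow_pos_of_pos hμ _).ne', Real.rpow_def_of_pos hμ, hexp,
    ← Real.exp_add, ← Real.exp_add, one_div, Real.log_inv]
  congr 1
  ring

end LimitShape

end

/-! ### Assembly of the cases -/

theorem theorem1 (u : ℝ → ℝ) (hu : AdmissiblePotential u)
    (hground : GroundStateUnattainable (energy u)) (β : ℝ) (hβ : 0 ≤ β) :
    -- the grand canonical ensembles and all expectations are well defined for `μ > 0`
    (∀ μ : ℝ, 0 < μ → WellDefined β (energy u) μ) ∧
    -- existence of the limit shape
    (SubLogarithmic (energy u) → (β = 0 ∨ HasExtendedLimit (energy u)) →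
      ∃ F : ℝ → ℝ, IsLimitShape β (energy u) F) ∧
    (Logarithmic (energy u) → β < 1 →
      ∃ F : ℝ → ℝ, IsLimitShape β (energy u) F) ∧
    -- infinite temperature
    (β = 0 → SubLogarithmic (energy u) ∨ Logarithmic (energy u) →
      IsLimitShape β (energy u) classicalShape ∧
      cellHeight β (energy u) ~[𝓝[>] 0] fun μ => 6 / Real.pi ^ 2 * μ) ∧
    -- decaying energies
    (Tendsto (energy u) atTop (𝓝 0) →
      IsLimitShape β (energy u) classicalShape ∧
      cellHeight β (energy u) ~[𝓝[>] 0] fun μ => 6 / Real.pi ^ 2 * μ) ∧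
    -- asymptotically constant energies
    (∀ c : ℝ, 0 < c → Tendsto (energy u) atTop (𝓝 c) →
      IsLimitShape β (energy u) (shiftedShape (β * c)) ∧
      cellHeight β (energy u) ~[𝓝[>] 0] fun μ => μ / dilog (Real.exp (-(β * c)))) ∧
    -- subcritical growth
    (0 < β → Tendsto (energy u) atTop atTop → SubLogarithmic (energy u) →
      IsLimitShape β (energy u) (fun x => Real.exp (-x)) ∧
      cellHeight β (energy u) ~[𝓝[>] 0] fun μ => μ * Real.exp (β * u (Real.log (1 / μ)))) ∧
    -- critical growth
    (0 < β → β < 1 → Logarithmic (energy u) →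
      IsLimitShape β (energy u) (gammaShape β) ∧
      (cellHeight β (energy u) ~[𝓝[>] 0] fun μ =>
        μ * Real.exp (β * u (Real.log (1 / μ))) / Real.Gamma (2 - β)) ∧
      (Tendsto (fun k : ℕ+ => energy u k - Real.log (k : ℝ)) atTop (𝓝 0) →
        cellHeight β (energy u) ~[𝓝[>] 0] fun μ => μ ^ (1 - β) / Real.Gamma (2 - β))) := by
  have hlog0 : ∀ k : ℕ+, 0 ≤ Real.log (k : ℝ) := fun k => Real.log_natCast_nonneg _
  have hE0 : ∀ k, 0 < energy u k := fun k => hu.pos _ (hlog0 k)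
  have hβE : ∀ k, 0 ≤ β * energy u k := fun k => mul_nonneg hβ (hE0 k).le
  obtain ⟨σ, hσ⟩ := hu.exists_deriv_lim
  have hzero : β = 0 → IsLimitShape β (energy u) classicalShape ∧
      cellHeight β (energy u) ~[𝓝[>] 0] fun μ => 6 / Real.pi ^ 2 * μ := fun h =>
    isLimitShape_classical hβE (by simp [h])
  have hdecay : Tendsto (energy u) atTop (𝓝 0) → IsLimitShape β (energy u) classicalShape ∧
      cellHeight β (energy u) ~[𝓝[>] 0] fun μ => 6 / Real.pi ^ 2 * μ := fun h =>
    isLimitShape_classical hβE (by simpa using h.const_mul β)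
  have hconst : ∀ c : ℝ, 0 < c → Tendsto (energy u) atTop (𝓝 c) →
      IsLimitShape β (energy u) (shiftedShape (β * c)) ∧
      cellHeight β (energy u) ~[𝓝[>] 0] fun μ => μ / dilog (Real.exp (-(β * c))) :=
    fun c hc h => isLimitShape_of_tendsto_nhds hβE (mul_nonneg hβ hc.le) (h.const_mul β)
  have hsub : 0 < β → Tendsto (energy u) atTop atTop → SubLogarithmic (energy u) →
      IsLimitShape β (energy u) (fun x => Real.exp (-x)) ∧
      cellHeight β (energy u) ~[𝓝[>] 0] fun μ => μ * Real.exp (β * u (Real.log (1 / μ))) := by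
    intro hβ' hE h
    obtain rfl := hu.deriv_lim_of_subLogarithmic hσ h
    have key := isLimitShape_of_tendsto_atTop hu hσ le_rfl hβ' (by simp) hE
      (F := fun x => Real.exp (-x)) (fun x _ => by simpa using (integral_exp_neg_Ioi x).symm)
    simpa [Real.Gamma_two] using key
  have hcrit : 0 < β → β < 1 → Logarithmic (energy u) →
      IsLimitShape β (energy u) (gammaShape β) ∧
      (cellHeight β (energy u) ~[𝓝[>] 0] fun μ =>
        μ * Real.exp (β * u (Real.log (1 / μ))) / Real.Gamma (2 - β)) := by
    intro hβ' hβ1 h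
    obtain rfl := hu.deriv_lim_of_logarithmic hσ h
    have key := isLimitShape_of_tendsto_atTop hu hσ zero_le_one hβ' (by simpa using hβ1)
      h.tendsto_atTop (F := gammaShape β) (fun x _ => by
        rw [gammaShape, mul_one, one_div, inv_mul_eq_div])
    simpa only [mul_one] using key
  refine ⟨fun μ hμ => wellDefined hβE hμ, ?_, ?_, fun h _ => hzero h, hdecay, hconst, hsub, ?_⟩
  · rintro hlog hor
    rcases hβ.eq_or_lt with h0 | hβ'
    · exact ⟨_, (hzero h0.symm).1⟩
    -- For positive `β` the limit of the energies is infinite, zero or positive and finite, one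
    -- shape for each.
    obtain ⟨l, hl⟩ := hor.resolve_left hβ'.ne'
    rcases eq_or_ne l ∞ with rfl | hltop
    · exact ⟨_, (hsub hβ' (ENNReal.tendsto_ofReal_nhds_top.1 hl) hlog).1⟩
    have hE : Tendsto (energy u) atTop (𝓝 l.toReal) := by
      refine ((ENNReal.tendsto_toReal hltop).comp hl).congr fun k => ?_
      exact ENNReal.toReal_ofReal (hE0 k).le
    rcases (ENNReal.toReal_nonneg (a := l)).eq_or_lt with h | h
    · exact ⟨_, (hdecay (h ▸ hE)).1⟩
    · exact ⟨_, (hconst _ h hE).1⟩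
  · intro hlog hβ1
    rcases hβ.eq_or_lt with h0 | hβ'
    · exact ⟨_, (hzero h0.symm).1⟩
    · exact ⟨_, (hcrit hβ' hβ1 hlog).1⟩
  · intro hβ' hβ1 hlog
    obtain ⟨h1, h2⟩ := hcrit hβ' hβ1 hlog
    exact ⟨h1, h2, fun h => h2.trans ((hu.isEquivalent_mul_exp hσ β h).div .refl)⟩
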